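/- A spectrally negative Lévy process $X$ (a real Lévy process with $X_0=0$ a.s., càdlàg paths and Lévy–Khintchine triplet $(\mu,\sigma,\Pi)$ with $\Pi(0,\infty)=0$; processes with monotone paths are excluded) has Laplace exponent $\psi$ given by $E(e^{\lambda X_t})=e^{\psi(\lambda)t}$, $\lambda,t\ge 0$. Write $\Phi(0)$ for the largest root of $\psi$ in $[0,\infty)$. The scale function of $X$ is the unique function $W:\mathbb R\to[0,\infty)$ that vanishes on $(-\infty,0)$, is right-continuous on $[0,\infty)$ and satisfies $\int_0^\infty e^{-\beta x}W(x)\,dx=1/\psi(\beta)$ for all $\beta>\Phi(0)$. It is called *complete* if the function $\phi$ in the Wiener–Hopf factorization $\psi(\theta)=(\theta-\Phi(0))\phi(\theta)$ is a complete Bernstein function, that is, $\phi(\theta)=\theta^2\int_0^\infty e^{-\theta x}\eta(x)\,dx$ for $\theta>0$ and some Bernstein function $\eta$ (a function of the form $\eta(\theta)=\kappa+\delta\theta+\int_{(0,\infty)}(1-e^{-\theta x})\,\Upsilon(dx)$, $\theta\ge 0$, with $\kappa,\delta\ge 0$ and $\int_{(0,\infty)}(1\wedge x)\,\Upsilon(dx)<\infty$).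 **Theorem.** Let $W$ be a complete scale function belonging to a spectrally negative Lévy process $X$ with paths of unbounded variation, whose Laplace exponent $\psi$ satisfies $\psi'(0+)=0$. Then there is a spectrally negative Lévy process $X^{\rm s}$ with Laplace exponent $$\psi^{\rm s}(\theta)=\frac{\theta\,\psi(\theta)}{\theta+\psi(\theta)},\quad \theta>0,\qquad \psi^{\rm s}(0)=0,$$ and its scale function is the function equal to $1+W(x)$ for $x\ge 0$ and to $0$ for $x<0$. Moreover, $(X_t+t)_{t\ge 0}$ is a spectrally negative Lévy process with Laplace exponent $\psi(\theta)+\theta$ and it has a scale function $\widetilde W$; and every spectrally negative Lévy process with Laplace exponent $\psi^{\rm s}$ has almost surely paths of bounded variation on compact time intervals, and its jump measure $\Pi^{\rm s}$ satisfies, for every $x>0$, that $\widetilde W$ is differentiable at $x$ and $$\Pi^{\rm s}(-\infty,-x)=\widetilde W'(x)<\infty .$$ -/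

import Mathlib

open MeasureTheory ProbabilityTheory Filter Topology Set
open scoped NNReal ENNReal

noncomputable section

/-- A path indexed by `[0, ∞)` is càdlàg: right continuous with left limits
(the condition on left limits is empty at time `0`). -/
def IsCadlagPath (f : ℝ≥0 → ℝ) : Prop :=
  ∀ t, ContinuousWithinAt f (Ici t) t ∧ ∃ l, Tendsto f (𝓝[<] t) (𝓝 l)

/-- Real-valued Lévy processes. -/
structure IsLevyProcess {Ω : Type*} [MeasurableSpace Ω] (X : ℝ≥0 → Ω → ℝ) (P : Measure Ω) :
    Prop where
  isProbabilityMeasure : IsProbabilityMeasure P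
  measurable : ∀ t, Measurable (X t)
  cadlag : ∀ ω, IsCadlagPath (fun t => X t ω)
  start_zero : ∀ᵐ ω ∂P, X 0 ω = 0
  indep_increments : HasIndepIncrements X P
  stationary_increments : ∀ s t : ℝ≥0, s ≤ t →
    P.map (fun ω => X t ω - X s ω) = P.map (X (t - s))

/-- The characteristic exponent
`Ψ(θ) = iμθ + σ²θ²/2 + ∫ (1 - e^{iθx} + iθx 1_{|x|<1}) ν(dx)`. -/
def levyKhintchineExponent (μ σ : ℝ) (ν : Measure ℝ) (θ : ℝ) : ℂ :=
  Complex.I * μ * θ + (σ : ℂ) ^ 2 / 2 * (θ : ℂ) ^ 2 +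
    ∫ x : ℝ, (1 - Complex.exp (Complex.I * θ * x) +
      Complex.I * θ * (if |x| < 1 then (x : ℂ) else 0)) ∂ν

/-- `(μ, σ, ν)` is a Lévy triplet of the process `X`; `ν` is its jump (Lévy) measure. -/
structure HasLevyTriplet {Ω : Type*} [MeasurableSpace Ω] (X : ℝ≥0 → Ω → ℝ) (P : Measure Ω)
    (μ σ : ℝ) (ν : Measure ℝ) : Prop where
  no_mass_zero : ν {0} = 0
  lintegral_lt_top : ∫⁻ x, ENNReal.ofReal (min 1 (x ^ 2)) ∂ν < ∞
  exponent : ∀ (t : ℝ≥0) (θ : ℝ), ∫ ω, Complex.exp (Complex.I * θ * X t ω) ∂P =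
    Complex.exp (-(t : ℂ) * levyKhintchineExponent μ σ ν θ)

/-- Spectrally negative Lévy processes: no positive jumps, processes with monotone paths being
excluded. -/
structure IsSpectrallyNegativeLevy {Ω : Type*} [MeasurableSpace Ω] (X : ℝ≥0 → Ω → ℝ)
    (P : Measure Ω) : Prop where
  isLevyProcess : IsLevyProcess X P
  jumps_neg : ∃ (μ σ : ℝ) (ν : Measure ℝ), HasLevyTriplet X P μ σ ν ∧ ν (Ioi 0) = 0
  not_monotone : ¬ ∀ᵐ ω ∂P, Monotone (fun t => X t ω)
  not_antitone : ¬ ∀ᵐ ω ∂P, Antitone (fun t => X t ω)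

/-- `ψ` is the Laplace exponent of `X`: `E[e^{λ X_t}] = e^{ψ(λ) t}` for all `λ ≥ 0`. Only the
values of `ψ` on `[0, ∞)` are relevant. -/
def HasLaplaceExponent {Ω : Type*} [MeasurableSpace Ω] (X : ℝ≥0 → Ω → ℝ) (P : Measure Ω)
    (ψ : ℝ → ℝ) : Prop :=
  ∀ (t : ℝ≥0) (l : ℝ), 0 ≤ l → Integrable (fun ω => Real.exp (l * X t ω)) P ∧
    ∫ ω, Real.exp (l * X t ω) ∂P = Real.exp (ψ l * t)

/-- Almost every path has bounded variation on every compact time interval. -/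
def HasBoundedVariationPaths {Ω : Type*} [MeasurableSpace Ω] (X : ℝ≥0 → Ω → ℝ)
    (P : Measure Ω) : Prop :=
  ∀ᵐ ω ∂P, LocallyBoundedVariationOn (fun t => X t ω) univ

/-- `Φ(0)`, the largest root of `ψ(λ) = 0` in `[0, ∞)`. -/
def largestRoot (ψ : ℝ → ℝ) : ℝ := sSup {l : ℝ | 0 ≤ l ∧ ψ l = 0}

/-- `W` is the scale function of the spectrally negative Lévy process with Laplace
exponent `ψ`. -/
structure IsScaleFunction (ψ W : ℝ → ℝ) : Prop where
  nonneg : ∀ x, 0 ≤ W x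
  eq_zero_of_neg : ∀ x, x < 0 → W x = 0
  right_continuous : ∀ x, 0 ≤ x → ContinuousWithinAt W (Ici x) x
  laplace : ∀ β, largestRoot ψ < β →
    IntegrableOn (fun x => Real.exp (-β * x) * W x) (Ioi 0) ∧
      ∫ x in Ioi 0, Real.exp (-β * x) * W x = 1 / ψ β

/-- Bernstein functions `φ(θ) = κ + δθ + ∫_{(0,∞)} (1 - e^{-θx}) Υ(dx)`, `θ ≥ 0`. -/
def IsBernstein (φ : ℝ → ℝ) : Prop :=
  ∃ (κ δ : ℝ) (U : Measure ℝ), 0 ≤ κ ∧ 0 ≤ δ ∧ U (Iic 0) = 0 ∧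
    ∫⁻ x, ENNReal.ofReal (min 1 x) ∂U < ∞ ∧
    ∀ θ, 0 ≤ θ → φ θ = κ + δ * θ + ∫ x, (1 - Real.exp (-θ * x)) ∂U

/-- Complete Bernstein functions `φ(θ) = θ² ∫_{(0,∞)} e^{-θx} η(x) dx` with `η` Bernstein. The
formula is meaningful for `θ > 0`; the value at `0` is the limit there and is not constrained. -/
def IsCompleteBernstein (φ : ℝ → ℝ) : Prop :=
  ∃ η : ℝ → ℝ, IsBernstein η ∧
    ∀ θ, 0 < θ → φ θ = θ ^ 2 * ∫ x in Ioi 0, Real.exp (-θ * x) * η x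

/-- `W` is a complete scale function with parent exponent `ψ`: it is the scale function for `ψ`,
and the Laplace exponent `φ` of the descending ladder height process of the parent process, given
by the Wiener-Hopf factorization `ψ(θ) = (θ - Φ(0)) φ(θ)`, is a complete Bernstein function. -/
def IsCompleteScaleFunction (ψ W : ℝ → ℝ) : Prop :=
  IsScaleFunction ψ W ∧ ∃ φ : ℝ → ℝ, IsCompleteBernstein φ ∧
    ∀ θ, 0 < θ → ψ θ = (θ - largestRoot ψ) * φ θ

/-- The function equal to `1 + W` on `[0, ∞)` and to `0` on `(-∞, 0)`. -/
def shiftedScale (W : ℝ → ℝ) : ℝ → ℝ := (Ici (0 : ℝ)).indicator (fun x => 1 + W x)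

/-- The exponent `ψˢ(θ) = θψ(θ) / (θ + ψ(θ))` (equal to `0` at `θ = 0`). -/
def shiftedExponent (ψ : ℝ → ℝ) : ℝ → ℝ := fun θ => θ * ψ θ / (θ + ψ θ)

end

/-! Since ψ'(0+) = 0, the exponent is positive on (0, ∞), so Φ(0) = 0 and φ(θ) = ψ(θ)/θ. Everything
rests on g(θ) = θ/(θ + ψ(θ)) = 1/(1 + φ(θ)). Reciprocals of complete Bernstein functions are
Stieltjes functions, so g is a mixture of the kernels 1/(θy + 1 - y), y ∈ [0, 1]; the ends y = 0 and
y = 1 stand for constants and multiples of 1/θ. The bound g ≤ 1 excludes 1/θ. Unbounded variation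
excludes the constant, because a positive lower bound on g would give ψ(θ) ≤ Cθ and then paths of
bounded variation. Hence g is the Laplace transform of a nonnegative, continuous, decreasing u that
vanishes at infinity (`IsResolventMean.exists_laplace_density`).

The function u then plays two roles. The identity ψˢ(θ) = θ - θ g(θ) exhibits ψˢ as the exponent of
a unit drift minus a driftless subordinator with Lévy tail u, and 1/(θ + ψ(θ)) = g(θ)/θ makes the
primitive of u the scale function of X_t + t. Uniqueness of scale functions
(`IsScaleFunction.unique`) and of Lévy measures (`HasLevyTriplet.levyMeasure_eq`) carries this over
to every process with exponent ψˢ. The claim on 1 + W is the identity 1/ψˢ = 1/θ + 1/ψ.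

Two ingredients are built by hand. The reciprocal of a rational complete Bernstein function is a
resolvent entry of a positive semidefinite matrix, which the spectral theorem makes a Stieltjes
function; the general case follows by Riemann sums and compactness. The subordinator sums jumps over
a Poisson process in the plane, assembled from independent unit squares (`exists_subordinator`). -/

/-! ### Uniqueness for Laplace transforms -/

/-- Finite measures on `[0, ∞)` are determined by the values of their Laplace transform at the
natural numbers. -/
theorem ext_of_integral_exp_neg_nat {μ ν : Measure ℝ} [IsFiniteMeasure μ] [IsFiniteMeasure ν]
    (hμ : ∀ᵐ x ∂μ, 0 ≤ x) (hν : ∀ᵐ x ∂ν, 0 ≤ x)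
    (h : ∀ k : ℕ, ∫ x, Real.exp (-(k * x)) ∂μ = ∫ x, Real.exp (-(k * x)) ∂ν) : μ = ν := by
  have hT : Measurable (fun x : ℝ => Real.exp (-x)) := by fun_prop
  have hint : ∀ (κ : Measure ℝ) [IsFiniteMeasure κ], (∀ᵐ x ∂κ, 0 ≤ x) → ∀ k : ℕ,
      Integrable (fun x => Real.exp (-x) ^ k) κ := by
    intro κ _ hκ k
    refine Integrable.of_bound (C := 1) (by fun_prop) ?_
    filter_upwards [hκ] with x hx
    rw [Real.norm_of_nonneg (by positivity)]
    exact pow_le_one₀ (by positivity) (by simpa using hx)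
  have hpoly : ∀ p : Polynomial ℝ,
      ∫ x, p.eval (Real.exp (-x)) ∂μ = ∫ x, p.eval (Real.exp (-x)) ∂ν := by
    intro p
    simp only [Polynomial.eval_eq_sum_range]
    rw [integral_finsetSum _ fun i _ => (hint μ hμ i).const_mul _,
      integral_finsetSum _ fun i _ => (hint ν hν i).const_mul _]
    refine Finset.sum_congr rfl fun i _ => ?_
    rw [integral_const_mul, integral_const_mul]
    congr 1
    simpa [← Real.exp_nat_mul] using h i
  have hpint : ∀ (κ : Measure ℝ) [IsFiniteMeasure κ], (∀ᵐ x ∂κ, 0 ≤ x) → ∀ p : Polynomial ℝ,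
      Integrable (fun x => p.eval (Real.exp (-x))) κ := by
    intro κ _ hκ p
    simp only [Polynomial.eval_eq_sum_range]
    exact integrable_finsetSum _ fun i _ => (hint κ hκ i).const_mul _
  -- Under x ↦ e^{-x} both measures live on (0, 1] and integrate every polynomial alike; Weierstrass
  -- approximation on [0, 1] extends this to bounded continuous functions. The map is then undone by
  -- y ↦ -log y.
  have hmap : μ.map (fun x => Real.exp (-x)) = ν.map (fun x => Real.exp (-x)) := by
    refine ext_of_forall_integral_eq_of_IsFiniteMeasure fun f => ?_
    rw [integral_map hT.aemeasurable f.continuous.aestronglyMeasurable,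
      integral_map hT.aemeasurable f.continuous.aestronglyMeasurable]
    have hfint : ∀ (κ : Measure ℝ) [IsFiniteMeasure κ],
        Integrable (fun x => f (Real.exp (-x))) κ := fun κ _ =>
      Integrable.of_bound (C := ‖f‖) (by fun_prop) (ae_of_all _ fun x => f.norm_coe_le_norm _)
    refine eq_of_forall_dist_le fun ε hε => ?_
    obtain ⟨p, hp⟩ := exists_polynomial_near_of_continuousOn 0 1 f f.continuous.continuousOn
      (ε / (μ.real univ + ν.real univ + 1)) (by positivity)
    have key : ∀ (κ : Measure ℝ) [IsFiniteMeasure κ], (∀ᵐ x ∂κ, 0 ≤ x) →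
        |∫ x, f (Real.exp (-x)) ∂κ - ∫ x, p.eval (Real.exp (-x)) ∂κ| ≤
          ε / (μ.real univ + ν.real univ + 1) * κ.real univ := by
      intro κ _ hκ
      rw [← integral_sub (hfint κ) (hpint κ hκ p), ← Real.norm_eq_abs]
      refine norm_integral_le_of_norm_le_const ?_
      filter_upwards [hκ] with x hx
      rw [Real.norm_eq_abs, abs_sub_comm]
      exact (hp _ ⟨by positivity, by simpa using hx⟩).le
    have h1 := key μ hμ
    have h2 := key ν hν
    rw [hpoly p] at h1
    rw [Real.dist_eq]
    calc _ ≤ _ := abs_sub_le _ (∫ x, p.eval (Real.exp (-x)) ∂ν) _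
      _ ≤ ε / (μ.real univ + ν.real univ + 1) * μ.real univ +
          ε / (μ.real univ + ν.real univ + 1) * ν.real univ :=
        add_le_add h1 (by rwa [abs_sub_comm])
      _ ≤ ε := by
        rw [← mul_add, div_mul_eq_mul_div, div_le_iff₀ (by positivity)]
        exact mul_le_mul_of_nonneg_left (by linarith) hε.le
  have hlog : ∀ κ : Measure ℝ,
      (κ.map (fun x => Real.exp (-x))).map (fun y => -Real.log y) = κ := by
    intro κ
    rw [Measure.map_map (by fun_prop) hT]
    simp [Function.comp_def]
  rw [← hlog μ, ← hlog ν, hmap]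

/-! ### Lévy–Khintchine exponents and uniqueness of the Lévy measure -/

/-- Second-order Taylor bound where |x| < 1 and |θx| ≤ 1. For |x| < 1 < |θx| the crude bound 2 +
|θx| is absorbed by 3(θx)², and for |x| ≥ 1 the bound 2 suffices. -/
theorem norm_levyKhintchine_integrand_le (θ x : ℝ) :
    ‖1 - Complex.exp (Complex.I * θ * x) +
      Complex.I * θ * (if |x| < 1 then (x : ℂ) else 0)‖ ≤ (3 * θ ^ 2 + 2) * min 1 (x ^ 2) := by
  have hexp : ‖Complex.exp (Complex.I * θ * x)‖ = 1 := by
    rw [show Complex.I * θ * x = ((θ * x : ℝ) : ℂ) * Complex.I by push_cast; ring]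
    exact Complex.norm_exp_ofReal_mul_I _
  have h2 : ‖1 - Complex.exp (Complex.I * θ * x)‖ ≤ 2 := by
    refine (norm_sub_le _ _).trans ?_
    rw [hexp, norm_one]; norm_num
  by_cases hx : |x| < 1
  · have hx2 : x ^ 2 ≤ 1 := by
      rw [← sq_abs]; exact pow_le_one₀ (abs_nonneg _) hx.le
    rw [if_pos hx, min_eq_right hx2]
    suffices ‖1 - Complex.exp (Complex.I * θ * x) + Complex.I * θ * x‖ ≤ 3 * (θ * x) ^ 2 by
      refine this.trans ?_
      nlinarith [sq_nonneg x]
    have hn : ‖Complex.I * θ * x‖ = |θ * x| := by simp [abs_mul]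
    by_cases hθ : |θ * x| ≤ 1
    · have := Complex.norm_exp_sub_one_sub_id_le (x := Complex.I * θ * x) (by rwa [hn])
      rw [hn, sq_abs] at this
      rw [← norm_neg, show -(1 - Complex.exp (Complex.I * θ * x) + Complex.I * θ * x) =
        Complex.exp (Complex.I * θ * x) - 1 - Complex.I * θ * x by ring]
      refine this.trans ?_
      nlinarith [sq_nonneg (θ * x)]
    · refine (norm_add_le _ _).trans ?_
      rw [hn, ← sq_abs (θ * x)]
      push Not at hθ
      nlinarith
  · have hx2 : 1 ≤ x ^ 2 := by
      rw [← sq_abs]; exact one_le_pow₀ (not_lt.1 hx)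
    rw [if_neg hx, min_eq_left hx2, mul_zero, add_zero]
    nlinarith [sq_nonneg θ]

theorem measurable_levyKhintchine_integrand (θ : ℝ) :
    Measurable fun x : ℝ => 1 - Complex.exp (Complex.I * θ * x) +
      Complex.I * θ * (if |x| < 1 then (x : ℂ) else 0) := by
  have : Measurable fun x : ℝ => if |x| < 1 then (x : ℂ) else 0 :=
    Measurable.ite (measurableSet_lt (by fun_prop) measurable_const) (by fun_prop) (by fun_prop)
  fun_prop

theorem integrable_min_one_sq {ν : Measure ℝ}
    (hν : ∫⁻ x, ENNReal.ofReal (min 1 (x ^ 2)) ∂ν < ∞) :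
    Integrable (fun x : ℝ => min 1 (x ^ 2)) ν := by
  refine ⟨by fun_prop, ?_⟩
  rw [hasFiniteIntegral_iff_ofReal (ae_of_all _ fun x => by positivity)]
  exact hν

theorem integrable_levyKhintchine_integrand {ν : Measure ℝ}
    (hν : ∫⁻ x, ENNReal.ofReal (min 1 (x ^ 2)) ∂ν < ∞) (θ : ℝ) :
    Integrable (fun x : ℝ => 1 - Complex.exp (Complex.I * θ * x) +
      Complex.I * θ * (if |x| < 1 then (x : ℂ) else 0)) ν := by
  refine ((integrable_min_one_sq hν).const_mul (3 * θ ^ 2 + 2)).mono'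
    (measurable_levyKhintchine_integrand θ).aestronglyMeasurable
    (ae_of_all _ fun x => norm_levyKhintchine_integrand_le θ x)

theorem one_sub_cos_nonneg (x : ℝ) : 0 ≤ 2 * (1 - Real.cos x) := by
  linarith [Real.cos_le_one x]

theorem integrable_one_sub_cos {ν : Measure ℝ}
    (hν : ∫⁻ x, ENNReal.ofReal (min 1 (x ^ 2)) ∂ν < ∞) (h : ℝ) :
    Integrable (fun x : ℝ => 2 * (1 - Real.cos (h * x))) ν := by
  refine ((integrable_min_one_sq hν).const_mul (4 + h ^ 2)).mono' (by fun_prop)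
    (ae_of_all _ fun x => ?_)
  rw [Real.norm_of_nonneg (one_sub_cos_nonneg _)]
  rcases min_cases 1 (x ^ 2) with ⟨h1, h2⟩ | ⟨h1, h2⟩ <;> rw [h1]
  · nlinarith [Real.neg_one_le_cos (h * x)]
  · have := Real.one_sub_sq_div_two_le_cos (x := h * x)
    nlinarith [sq_nonneg x]

/-- The second difference of a characteristic exponent is the characteristic function of a finite
measure which is equivalent to the Lévy measure near each nonzero point. -/
theorem levyKhintchineExponent_second_difference {μ σ : ℝ} {ν : Measure ℝ}
    (hν : ∫⁻ x, ENNReal.ofReal (min 1 (x ^ 2)) ∂ν < ∞) (h θ : ℝ) :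
    levyKhintchineExponent μ σ ν (θ + h) + levyKhintchineExponent μ σ ν (θ - h)
      - 2 * levyKhintchineExponent μ σ ν θ =
    charFun (ν.withDensity (fun x => ENNReal.ofReal (2 * (1 - Real.cos (h * x)))) +
      ENNReal.ofReal (σ ^ 2 * h ^ 2) • Measure.dirac 0) θ := by
  have hfin : IsFiniteMeasure
      (ν.withDensity (fun x => ENNReal.ofReal (2 * (1 - Real.cos (h * x))))) :=
    isFiniteMeasure_withDensity_ofReal (integrable_one_sub_cos hν h).2
  have hfin' : IsFiniteMeasure
      (ENNReal.ofReal (σ ^ 2 * h ^ 2) • Measure.dirac (0 : ℝ)) :=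
    Measure.smul_finite _ ENNReal.ofReal_ne_top
  have hexpint : ∀ (κ : Measure ℝ) [IsFiniteMeasure κ],
      Integrable (fun x : ℝ => Complex.exp (θ * x * Complex.I)) κ := fun κ _ => by
    refine Integrable.of_bound (C := 1) (by fun_prop) (ae_of_all _ fun x => ?_)
    rw [← Complex.ofReal_mul, Complex.norm_exp_ofReal_mul_I]
  rw [charFun_apply_real, integral_add_measure (hexpint _) (hexpint _), integral_smul_measure,
    integral_dirac, ENNReal.toReal_ofReal (by positivity),
    integral_withDensity_eq_integral_toReal_smul (by fun_prop)
      (ae_of_all _ fun _ => ENNReal.ofReal_lt_top)]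
  simp only [levyKhintchineExponent]
  have e1 := integrable_levyKhintchine_integrand hν (θ + h)
  have e2 := integrable_levyKhintchine_integrand hν (θ - h)
  have e3 := integrable_levyKhintchine_integrand hν θ
  -- Drift and compensator are linear in θ and cancel in the second difference; the exponentials
  -- combine to e^{iθx} · 2(1 - cos hx). The Gaussian part is left over as the atom σ²h² at 0.
  have key : ∫ x : ℝ, (ENNReal.ofReal (2 * (1 - Real.cos (h * x)))).toReal •
      Complex.exp (θ * x * Complex.I) ∂ν =
    (∫ x : ℝ, (1 - Complex.exp (Complex.I * (θ + h : ℝ) * x) +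
      Complex.I * (θ + h : ℝ) * (if |x| < 1 then (x : ℂ) else 0)) ∂ν) +
    (∫ x : ℝ, (1 - Complex.exp (Complex.I * (θ - h : ℝ) * x) +
      Complex.I * (θ - h : ℝ) * (if |x| < 1 then (x : ℂ) else 0)) ∂ν) -
    2 * ∫ x : ℝ, (1 - Complex.exp (Complex.I * θ * x) +
      Complex.I * θ * (if |x| < 1 then (x : ℂ) else 0)) ∂ν := by
    rw [← integral_const_mul, ← integral_add e1 e2]
    refine Eq.trans ?_ (integral_sub (e1.add e2) (e3.const_mul 2))
    refine integral_congr_ae (ae_of_all _ fun x => ?_)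
    simp only
    rw [ENNReal.toReal_ofReal (one_sub_cos_nonneg _), Complex.real_smul]
    push_cast
    have a1 : Complex.exp (Complex.I * (θ + h) * x) =
        Complex.exp (θ * x * Complex.I) * Complex.exp (h * x * Complex.I) := by
      rw [← Complex.exp_add]; ring_nf
    have a2 : Complex.exp (Complex.I * (θ - h) * x) =
        Complex.exp (θ * x * Complex.I) * Complex.exp (-(h * x) * Complex.I) := by
      rw [← Complex.exp_add]; ring_nf
    have a3 : Complex.exp (Complex.I * θ * x) = Complex.exp (θ * x * Complex.I) := by
      ring_nf
    rw [a1, a2, a3]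
    have a4 : Complex.exp (h * x * Complex.I) + Complex.exp (-(h * x) * Complex.I) =
        2 * Complex.cos (h * x) := by
      rw [Complex.cos]; ring
    linear_combination (Complex.exp (θ * x * Complex.I)) * a4
  rw [key]
  simp only [Complex.ofReal_zero, mul_zero, zero_mul, Complex.exp_zero, Complex.real_smul]
  push_cast
  ring

/-- The Lévy measure is determined by the characteristic exponent. -/
theorem levyMeasure_unique {μ₁ σ₁ μ₂ σ₂ : ℝ} {ν₁ ν₂ : Measure ℝ}
    (h01 : ν₁ {0} = 0) (h02 : ν₂ {0} = 0)
    (h1 : ∫⁻ x, ENNReal.ofReal (min 1 (x ^ 2)) ∂ν₁ < ∞)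
    (h2 : ∫⁻ x, ENNReal.ofReal (min 1 (x ^ 2)) ∂ν₂ < ∞)
    (h : ∀ θ, levyKhintchineExponent μ₁ σ₁ ν₁ θ = levyKhintchineExponent μ₂ σ₂ ν₂ θ) :
    ν₁ = ν₂ := by
  have hdens : ∀ r : ℝ, ν₁.withDensity (fun x => ENNReal.ofReal (2 * (1 - Real.cos (r * x)))) =
      ν₂.withDensity (fun x => ENNReal.ofReal (2 * (1 - Real.cos (r * x)))) := by
    intro r
    have f1 : IsFiniteMeasure
        (ν₁.withDensity (fun x => ENNReal.ofReal (2 * (1 - Real.cos (r * x))))) :=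
      isFiniteMeasure_withDensity_ofReal (integrable_one_sub_cos h1 r).2
    have f2 : IsFiniteMeasure
        (ν₂.withDensity (fun x => ENNReal.ofReal (2 * (1 - Real.cos (r * x))))) :=
      isFiniteMeasure_withDensity_ofReal (integrable_one_sub_cos h2 r).2
    have f3 : IsFiniteMeasure (ENNReal.ofReal (σ₁ ^ 2 * r ^ 2) • Measure.dirac (0 : ℝ)) :=
      Measure.smul_finite _ ENNReal.ofReal_ne_top
    have f4 : IsFiniteMeasure (ENNReal.ofReal (σ₂ ^ 2 * r ^ 2) • Measure.dirac (0 : ℝ)) :=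
      Measure.smul_finite _ ENNReal.ofReal_ne_top
    have := Measure.ext_of_charFun (funext fun θ => by
      rw [← levyKhintchineExponent_second_difference (μ := μ₁) h1 r θ,
        ← levyKhintchineExponent_second_difference (μ := μ₂) h2 r θ, h, h, h] :
      charFun (ν₁.withDensity (fun x => ENNReal.ofReal (2 * (1 - Real.cos (r * x)))) +
        ENNReal.ofReal (σ₁ ^ 2 * r ^ 2) • Measure.dirac 0) =
      charFun (ν₂.withDensity (fun x => ENNReal.ofReal (2 * (1 - Real.cos (r * x)))) +
        ENNReal.ofReal (σ₂ ^ 2 * r ^ 2) • Measure.dirac 0))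
    -- Removing the origin discards the Gaussian atoms, and loses nothing of the Lévy measures.
    have hr := congrArg (fun κ : Measure ℝ => κ.restrict {0}ᶜ) this
    have aux : ∀ (ν : Measure ℝ), ν {0} = 0 → ν.restrict {0}ᶜ = ν := fun ν h0 =>
      Measure.restrict_eq_self_of_ae_mem (by rw [ae_iff]; simpa using h0)
    have hd : (Measure.dirac (0 : ℝ)).restrict {0}ᶜ = 0 := by
      rw [Measure.restrict_eq_zero]; simp
    simpa [Measure.restrict_add, Measure.restrict_smul, hd, aux _ h01, aux _ h02,
      restrict_withDensity] using hr
  have hU : (⋃ n : ℕ, Icc (-(n + 1 : ℝ)) (n + 1)) = univ := by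
    refine eq_univ_of_forall fun x => ?_
    obtain ⟨n, hn⟩ := exists_nat_ge |x|
    exact mem_iUnion.2 ⟨n, by constructor <;> linarith [abs_le.1 hn]⟩
  refine Measure.ext_of_iUnion_eq_univ hU fun n => ?_
  -- With frequency r = 1/(n+1) one has |rx| ≤ 1 < 2π on the window, so the density 2(1 - cos rx)
  -- vanishes only at 0 and can be divided out.
  have aux : ∀ ν : Measure ℝ, ν {0} = 0 → ν.restrict (Icc (-(n + 1 : ℝ)) (n + 1)) =
      ((ν.withDensity (fun x =>
        ENNReal.ofReal (2 * (1 - Real.cos ((n + 1 : ℝ)⁻¹ * x))))).restrict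
        (Icc (-(n + 1 : ℝ)) (n + 1))).withDensity (fun x =>
        (ENNReal.ofReal (2 * (1 - Real.cos ((n + 1 : ℝ)⁻¹ * x))))⁻¹) := by
    intro ν h0
    rw [restrict_withDensity measurableSet_Icc]
    refine (withDensity_inv_same (by fun_prop) ?_ ?_).symm
    · rw [ae_restrict_iff' measurableSet_Icc]
      have : ∀ᵐ x ∂ν, x ≠ 0 := by rw [ae_iff]; simpa using h0
      filter_upwards [this] with x hx hxI
      rw [ne_eq, ENNReal.ofReal_eq_zero, not_le]
      have hle : |(n + 1 : ℝ)⁻¹ * x| ≤ 1 := by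
        rw [abs_mul, abs_of_pos (by positivity), inv_mul_le_iff₀ (by positivity), mul_one]
        exact abs_le.2 hxI
      have hne : (n + 1 : ℝ)⁻¹ * x ≠ 0 := mul_ne_zero (by positivity) hx
      have hcos : Real.cos ((n + 1 : ℝ)⁻¹ * x) ≠ 1 := by
        rw [ne_eq, Real.cos_eq_one_iff_of_lt_of_lt] <;> grind [Real.pi_gt_three, abs_le]
      linarith [lt_of_le_of_ne (Real.cos_le_one _) hcos]
    · exact ae_of_all _ fun x => ENNReal.ofReal_ne_top
  rw [aux ν₁ h01, aux ν₂ h02, hdens]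

/-- The Lévy measure is determined by the one-dimensional characteristic functions. -/
theorem HasLevyTriplet.levyMeasure_eq {Ω Ω' : Type*} [MeasurableSpace Ω] [MeasurableSpace Ω']
    {X : ℝ≥0 → Ω → ℝ} {P : Measure Ω} {Y : ℝ≥0 → Ω' → ℝ} {P' : Measure Ω'}
    {μ₁ σ₁ μ₂ σ₂ : ℝ} {ν₁ ν₂ : Measure ℝ}
    (hX : HasLevyTriplet X P μ₁ σ₁ ν₁) (hY : HasLevyTriplet Y P' μ₂ σ₂ ν₂)
    (h : ∀ (t : ℝ≥0) (θ : ℝ), ∫ ω, Complex.exp (Complex.I * θ * X t ω) ∂P =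
      ∫ ω, Complex.exp (Complex.I * θ * Y t ω) ∂P') : ν₁ = ν₂ := by
  refine levyMeasure_unique hX.no_mass_zero hY.no_mass_zero hX.lintegral_lt_top
    hY.lintegral_lt_top (fun θ => ?_) (μ₁ := μ₁) (σ₁ := σ₁) (μ₂ := μ₂) (σ₂ := σ₂)
  set a := levyKhintchineExponent μ₁ σ₁ ν₁ θ
  set b := levyKhintchineExponent μ₂ σ₂ ν₂ θ
  have hexp : ∀ t : ℝ, 0 ≤ t → Complex.exp (-(t : ℂ) * a) = Complex.exp (-(t : ℂ) * b) := by
    intro t ht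
    exact (hX.exponent ⟨t, ht⟩ θ).symm.trans ((h ⟨t, ht⟩ θ).trans (hY.exponent ⟨t, ht⟩ θ))
  -- The exponent is read off as the right derivative of e^{-tc} at t = 0, so no branch of the
  -- complex logarithm enters.
  have hd : ∀ c : ℂ, HasDerivWithinAt (fun t : ℝ => Complex.exp (-(t : ℂ) * c)) (-c) (Ici 0) 0 := by
    intro c
    have h1 : HasDerivAt (fun t : ℝ => -(t : ℂ) * c) (-c) 0 := by
      simpa using ((Complex.ofRealCLM.hasDerivAt (x := (0 : ℝ))).neg).mul_const c
    simpa using h1.cexp.hasDerivWithinAt (s := Ici 0)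
  have := (hd a).congr (f₁ := fun t : ℝ => Complex.exp (-(t : ℂ) * b))
    (fun t ht => (hexp t ht).symm) (hexp 0 le_rfl).symm
  exact neg_injective ((uniqueDiffWithinAt_Ici (0 : ℝ)).eq_deriv _ this (hd b))

/-! ### Path properties from the Laplace exponent -/

/-- A right-continuous function on `[0, ∞)` which is monotone on a dense set is monotone. -/
theorem monotone_of_monotoneOn_dense {f : ℝ≥0 → ℝ} {D : Set ℝ≥0} (hD : Dense D)
    (hf : ∀ t, ContinuousWithinAt f (Ici t) t) (hmono : MonotoneOn f D) : Monotone f := by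
  have hne : ∀ s : ℝ≥0, (𝓝[D ∩ Ioi s] s).NeBot := fun s => by
    rw [← mem_closure_iff_nhdsWithin_neBot, inter_comm]
    refine closure_minimal (hD.open_subset_closure_inter isOpen_Ioi) isClosed_closure ?_
    rw [closure_Ioi]
    exact self_mem_Ici
  have hlim : ∀ s, Tendsto f (𝓝[D ∩ Ioi s] s) (𝓝 (f s)) := fun s =>
    (hf s).mono_left (nhdsWithin_mono _ fun x hx => Ioi_subset_Ici_self hx.2)
  have step : ∀ s, ∀ d ∈ D, s < d → f s ≤ f d := by
    intro s d hd hsd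
    have := hne s
    refine le_of_tendsto (hlim s) ?_
    filter_upwards [self_mem_nhdsWithin, mem_nhdsWithin_of_mem_nhds (Iio_mem_nhds hsd)]
      with x hx hxd using hmono hx.1 hd (le_of_lt hxd)
  intro s t hst
  have := hne t
  refine ge_of_tendsto (hlim t) ?_
  filter_upwards [self_mem_nhdsWithin] with x hx using step s x hx.1 (hst.trans_lt hx.2)

section LevyPaths

variable {Ω : Type*} [MeasurableSpace Ω] {P : Measure Ω} {X : ℝ≥0 → Ω → ℝ} {ψ : ℝ → ℝ}

/-- Stationarity turns the bound at one time into a bound on each increment. A countable dense set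
of times needs only one null set, and right-continuity gives the remaining times. -/
theorem IsLevyProcess.ae_monotone_mul_sub (hX : IsLevyProcess X P) {c : ℝ}
    (h : ∀ t, ∀ᵐ ω ∂P, X t ω ≤ c * t) :
    ∀ᵐ ω ∂P, Monotone fun t : ℝ≥0 => c * t - X t ω := by
  obtain ⟨D, hDc, hD⟩ := TopologicalSpace.exists_countable_dense ℝ≥0
  have hinc : ∀ s t : ℝ≥0, s ≤ t → ∀ᵐ ω ∂P, X t ω - X s ω ≤ c * (t - s) := by
    intro s t hst
    have h1 : ∀ᵐ x ∂(P.map (X (t - s))), x ≤ c * ((t - s : ℝ≥0) : ℝ) :=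
      (ae_map_iff (hX.measurable _).aemeasurable measurableSet_Iic).2 (h (t - s))
    rw [← hX.stationary_increments s t hst] at h1
    have h2 := ae_of_ae_map ((hX.measurable t).sub (hX.measurable s)).aemeasurable h1
    simpa [NNReal.coe_sub hst] using h2
  have hall : ∀ᵐ ω ∂P, ∀ s ∈ D, ∀ t ∈ D, s ≤ t → X t ω - X s ω ≤ c * (t - s) := by
    rw [ae_ball_iff hDc]; intro s _
    rw [ae_ball_iff hDc]; intro t _
    exact eventually_imp_distrib_left.2 (hinc s t)
  filter_upwards [hall] with ω hω
  refine monotone_of_monotoneOn_dense hD (fun t => ?_) fun s hs t ht hst => ?_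
  · exact (Continuous.continuousWithinAt (by fun_prop)).sub (hX.cadlag ω t).1
  · have := hω s hs t ht hst
    linarith

/-- The increments of `f` are dominated by those of the monotone function ct + g(t), hence so are
its variation sums. -/
theorem locallyBoundedVariationOn_of_monotone {f g : ℝ≥0 → ℝ} {c : ℝ} (hc : 0 ≤ c)
    (hg : Monotone g) (h : ∀ s t, s ≤ t → |f t - f s| ≤ c * (t - s) + (g t - g s)) :
    LocallyBoundedVariationOn f univ := by
  have hm : Monotone fun t : ℝ≥0 => c * (t : ℝ) + g t := fun s t hst =>
    add_le_add (mul_le_mul_of_nonneg_left hst hc) (hg hst)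
  intro a b ha hb
  refine ne_top_of_le_ne_top ((hm.monotoneOn univ).locallyBoundedVariationOn a b ha hb) ?_
  refine iSup_mono fun p => Finset.sum_le_sum fun i _ => ?_
  have hp : p.2.1 i ≤ p.2.1 (i + 1) := p.2.2.1 (Nat.le_succ i)
  rw [edist_dist, edist_dist, Real.dist_eq, Real.dist_eq]
  refine ENNReal.ofReal_le_ofReal ((h _ _ hp).trans (le_trans (le_of_eq ?_) (le_abs_self _)))
  ring

theorem hasBoundedVariationPaths_of_monotone_mul_sub {c : ℝ}
    (h : ∀ᵐ ω ∂P, Monotone fun t : ℝ≥0 => c * t - X t ω) : HasBoundedVariationPaths X P := by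
  filter_upwards [h] with ω hω
  refine locallyBoundedVariationOn_of_monotone (abs_nonneg c) hω fun s t hst => ?_
  have h1 := hω hst
  have h2 : |c * ((t : ℝ) - s)| = |c| * (t - s) := by
    rw [abs_mul, abs_of_nonneg (sub_nonneg.2 (NNReal.coe_le_coe.2 hst))]
  rw [← h2, show X t ω - X s ω = c * ((t : ℝ) - s) - ((c * t - X t ω) - (c * s - X s ω)) by ring]
  exact (abs_sub _ _).trans (add_le_add le_rfl (abs_of_nonneg (sub_nonneg.2 h1)).le)

/-- Chernoff's bound gives P(X_t ≥ ct + ε) ≤ e^{-lε} for every l > 0; let l → ∞ and then ε → 0. -/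
theorem HasLaplaceExponent.ae_le_mul [IsProbabilityMeasure P] (hψ : HasLaplaceExponent X P ψ)
    {c : ℝ} (h : ∀ l, 0 < l → ψ l ≤ c * l) (t : ℝ≥0) : ∀ᵐ ω ∂P, X t ω ≤ c * t := by
  have key : ∀ ε : ℝ, 0 < ε → P {ω | c * t + ε ≤ X t ω} = 0 := by
    intro ε hε
    have hle : ∀ l : ℝ, 0 < l → P.real {ω | c * t + ε ≤ X t ω} ≤ Real.exp (-(l * ε)) := by
      intro l hl
      have h1 := measure_ge_le_exp_mul_mgf (c * t + ε) hl.le (hψ t l hl.le).1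
      rw [mgf, (hψ t l hl.le).2, ← Real.exp_add] at h1
      refine h1.trans (Real.exp_le_exp.2 ?_)
      have : ψ l * t ≤ c * l * t := mul_le_mul_of_nonneg_right (h l hl) t.2
      linarith
    have hlim : Tendsto (fun l : ℝ => Real.exp (-(l * ε))) atTop (𝓝 0) :=
      Real.tendsto_exp_neg_atTop_nhds_zero.comp (tendsto_id.atTop_mul_const hε)
    have h0 : P.real {ω | c * t + ε ≤ X t ω} ≤ 0 :=
      ge_of_tendsto hlim ((eventually_gt_atTop 0).mono hle)
    exact (measureReal_eq_zero_iff (measure_ne_top _ _)).1 (le_antisymm h0 measureReal_nonneg)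
  have hall : ∀ᵐ ω ∂P, ∀ n : ℕ, X t ω < c * t + 1 / ((n : ℝ) + 1) := by
    rw [ae_all_iff]; intro n
    rw [ae_iff]
    simpa using key (1 / ((n : ℝ) + 1)) (by positivity)
  filter_upwards [hall] with ω hω
  have hlim := (tendsto_one_div_add_atTop_nhds_zero_nat (𝕜 := ℝ)).const_add (c * t)
  rw [add_zero] at hlim
  exact ge_of_tendsto hlim (Eventually.of_forall fun n => (hω n).le)

/-- A Lévy process whose Laplace exponent is dominated by a linear function has paths of bounded
variation. -/
theorem IsLevyProcess.hasBoundedVariationPaths (hX : IsLevyProcess X P)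
    (hψ : HasLaplaceExponent X P ψ) {c : ℝ} (h : ∀ l, 0 < l → ψ l ≤ c * l) :
    HasBoundedVariationPaths X P :=
  have := hX.isProbabilityMeasure
  hasBoundedVariationPaths_of_monotone_mul_sub (hX.ae_monotone_mul_sub (hψ.ae_le_mul h))

theorem HasLaplaceExponent.apply_zero [IsProbabilityMeasure P]
    (hψ : HasLaplaceExponent X P ψ) : ψ 0 = 0 := by
  have := (hψ 1 0 le_rfl).2
  simpa using this.symm

theorem HasLaplaceExponent.tendsto_div [IsProbabilityMeasure P]
    (hψ : HasLaplaceExponent X P ψ) (hd : HasDerivWithinAt ψ 0 (Ioi 0) 0) :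
    Tendsto (fun θ => ψ θ / θ) (𝓝[>] 0) (𝓝 0) := by
  have := hasDerivWithinAt_iff_tendsto_slope.1 hd
  simpa [slope_fun_def_field, hψ.apply_zero] using this

/-- Only this much of the convexity of `ψ` is needed. It is E[(Z - a)²] ≥ 0 for Z = e^{θX_1/2} with
mean a. -/
theorem HasLaplaceExponent.two_mul_half_le [IsProbabilityMeasure P]
    (hψ : HasLaplaceExponent X P ψ) {θ : ℝ} (hθ : 0 ≤ θ) : 2 * ψ (θ / 2) ≤ ψ θ := by
  have h1 := hψ 1 (θ / 2) (by positivity)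
  have h2 := hψ 1 θ hθ
  set a := Real.exp (ψ (θ / 2)) with ha
  have hsq : ∀ ω, Real.exp (θ * X 1 ω) = Real.exp (θ / 2 * X 1 ω) ^ 2 := fun ω => by
    rw [← Real.exp_nat_mul]; congr 1; push_cast; ring
  have hint : Integrable (fun ω => 2 * a * Real.exp (θ / 2 * X 1 ω) - a ^ 2) P :=
    (h1.1.const_mul _).sub (integrable_const _)
  have := integral_mono hint h2.1 (fun ω => by
    simp only [hsq]
    nlinarith [sq_nonneg (Real.exp (θ / 2 * X 1 ω) - a)])
  rw [integral_sub (h1.1.const_mul _) (integrable_const _), integral_const_mul, h1.2, h2.2] at this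
  simp only [NNReal.coe_one, mul_one, integral_const, probReal_univ, smul_eq_mul, one_mul,
    ← ha] at this
  rw [← Real.exp_le_exp]
  calc Real.exp (2 * ψ (θ / 2)) = a ^ 2 := by rw [ha, ← Real.exp_nat_mul]; push_cast; rfl
    _ ≤ _ := by linarith

/-- Iterated halving gives ψ(θ) ≥ 2ⁿψ(θ/2ⁿ), which is θ times the slope of `ψ` from 0 to θ/2ⁿ and
tends to 0. -/
theorem HasLaplaceExponent.nonneg_of_tendsto [IsProbabilityMeasure P]
    (hψ : HasLaplaceExponent X P ψ) (hd : Tendsto (fun θ => ψ θ / θ) (𝓝[>] 0) (𝓝 0))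
    {θ : ℝ} (hθ : 0 < θ) : 0 ≤ ψ θ := by
  have hit : ∀ n : ℕ, 2 ^ n * ψ (θ / 2 ^ n) ≤ ψ θ := by
    intro n
    induction n with
    | zero => simp
    | succ n ih =>
      have := hψ.two_mul_half_le (θ := θ / 2 ^ n) (by positivity)
      rw [div_div, ← pow_succ] at this
      calc _ = 2 ^ n * (2 * ψ (θ / 2 ^ (n + 1))) := by ring
        _ ≤ 2 ^ n * ψ (θ / 2 ^ n) := by gcongr
        _ ≤ _ := ih
  have hseq : Tendsto (fun n : ℕ => θ / 2 ^ n) atTop (𝓝[>] 0) := by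
    refine tendsto_nhdsWithin_iff.2 ⟨?_, Eventually.of_forall fun n => ?_⟩
    · exact tendsto_const_nhds.div_atTop (tendsto_pow_atTop_atTop_of_one_lt one_lt_two)
    · simp only [mem_Ioi]; positivity
  have hlim := (hd.comp hseq).const_mul θ
  rw [mul_zero] at hlim
  refine le_of_tendsto hlim (Eventually.of_forall fun n => ?_)
  refine le_trans (le_of_eq ?_) (hit n)
  simp only [Function.comp]
  field_simp

/-- The equality case of the halving inequality: e^{θX_t/2} has first and second moment 1, hence
variance 0. -/
theorem HasLaplaceExponent.ae_eq_zero [IsProbabilityMeasure P]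
    (hψ : HasLaplaceExponent X P ψ) {θ : ℝ} (hθ : 0 < θ) (h0 : ψ θ = 0) (h1 : ψ (θ / 2) = 0)
    (t : ℝ≥0) : ∀ᵐ ω ∂P, X t ω = 0 := by
  have e1 := hψ t (θ / 2) (by positivity)
  have e2 := hψ t θ hθ.le
  rw [h1, zero_mul, Real.exp_zero] at e1
  rw [h0, zero_mul, Real.exp_zero] at e2
  have hsq : ∀ ω, (Real.exp (θ / 2 * X t ω) - 1) ^ 2 =
      Real.exp (θ * X t ω) - 2 * Real.exp (θ / 2 * X t ω) + 1 := fun ω => by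
    have : Real.exp (θ * X t ω) = Real.exp (θ / 2 * X t ω) ^ 2 := by
      rw [← Real.exp_nat_mul]; congr 1; push_cast; ring
    rw [this]; ring
  have hint : Integrable (fun ω => (Real.exp (θ / 2 * X t ω) - 1) ^ 2) P := by
    simp only [hsq]
    exact (e2.1.sub (e1.1.const_mul 2)).add (integrable_const _)
  have hzero : ∫ ω, (Real.exp (θ / 2 * X t ω) - 1) ^ 2 ∂P = 0 := by
    simp only [hsq]
    have e3 := integral_add (e2.1.sub (e1.1.const_mul 2)) (integrable_const (μ := P) (1 : ℝ))
    have e4 := integral_sub e2.1 (e1.1.const_mul 2)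
    rw [integral_const_mul, e1.2, e2.2] at e4
    simp only [Pi.sub_apply] at e3
    rw [e3, e4]
    norm_num
  have hae := (integral_eq_zero_iff_of_nonneg (fun ω => sq_nonneg _) hint).1 hzero
  filter_upwards [hae] with ω hω
  have h3 : Real.exp (θ / 2 * X t ω) = 1 := by
    have := pow_eq_zero_iff (two_ne_zero) |>.1 hω
    linarith
  have := (Real.exp_eq_one_iff _).1 h3
  rcases mul_eq_zero.1 this with h | h
  · linarith
  · exact h

/-- The Laplace exponent of a spectrally negative Lévy process with `ψ'(0+) = 0` is positive on
`(0, ∞)`. -/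
theorem IsSpectrallyNegativeLevy.exponent_pos (hX : IsSpectrallyNegativeLevy X P)
    (hψ : HasLaplaceExponent X P ψ) (hd : Tendsto (fun θ => ψ θ / θ) (𝓝[>] 0) (𝓝 0))
    {θ : ℝ} (hθ : 0 < θ) : 0 < ψ θ := by
  have := hX.isLevyProcess.isProbabilityMeasure
  refine lt_of_le_of_ne (hψ.nonneg_of_tendsto hd hθ) fun h0 => hX.not_antitone ?_
  have h1 : ψ (θ / 2) = 0 := by
    have a := hψ.two_mul_half_le hθ.le
    have b := hψ.nonneg_of_tendsto hd (half_pos hθ)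
    linarith
  have hm := hX.isLevyProcess.ae_monotone_mul_sub (c := 0) fun t => by
    filter_upwards [hψ.ae_eq_zero hθ h0.symm h1 t] with ω hω
    simp [hω]
  filter_upwards [hm] with ω hω s t hst
  have := hω hst
  simpa using this

/-- A Lévy process with positive Laplace exponent `ψ` such that `ψ'(0+) = 0` does not have monotone
paths. -/
theorem IsLevyProcess.not_monotone_of_exponent (hX : IsLevyProcess X P)
    (hψ : HasLaplaceExponent X P ψ) (hd : Tendsto (fun θ => ψ θ / θ) (𝓝[>] 0) (𝓝 0))
    (hpos : 0 < ψ 1) :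
    (¬ ∀ᵐ ω ∂P, Monotone (fun t => X t ω)) ∧ ¬ ∀ᵐ ω ∂P, Antitone (fun t => X t ω) := by
  have := hX.isProbabilityMeasure
  constructor
  · intro hm
    have hnn : ∀ᵐ ω ∂P, 0 ≤ X 1 ω := by
      filter_upwards [hm, hX.start_zero] with ω h1 h2
      rw [← h2]; exact h1 zero_le_one
    have hint : Integrable (X 1) P := by
      refine (hψ 1 1 zero_le_one).1.mono' (hX.measurable 1).aestronglyMeasurable ?_
      filter_upwards [hnn] with ω hω
      rw [Real.norm_of_nonneg hω, one_mul]
      linarith [Real.add_one_le_exp (X 1 ω)]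
    -- From 1 + x ≤ e^x. As θ ↓ 0 the right side tends to ψ'(0+) = 0, so a nonnegative X_1 has mean
    -- 0 and vanishes, against ψ(1) > 0.
    have hle : ∀ θ : ℝ, 0 < θ → ∫ ω, X 1 ω ∂P ≤ (Real.exp (ψ θ) - 1) / θ := by
      intro θ hθ
      have h1 := hψ 1 θ hθ.le
      have h2 := integral_mono ((hint.const_mul θ).add (integrable_const 1)) h1.1
        (fun ω => Real.add_one_le_exp (θ * X 1 ω))
      rw [integral_add' (hint.const_mul θ) (integrable_const 1), integral_const_mul, h1.2] at h2
      rw [le_div_iff₀ hθ]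
      simp at h2
      linarith
    have hψ0 : Tendsto ψ (𝓝[>] 0) (𝓝 0) := by
      have h1 : Tendsto (fun θ : ℝ => θ) (𝓝[>] 0) (𝓝 0) := tendsto_id.mono_left nhdsWithin_le_nhds
      have h2 := hd.mul h1
      rw [zero_mul] at h2
      refine h2.congr' ?_
      filter_upwards [self_mem_nhdsWithin] with θ hθ
      exact div_mul_cancel₀ _ (ne_of_gt hθ)
    have hlim : Tendsto (fun θ => (Real.exp (ψ θ) - 1) / θ) (𝓝[>] 0) (𝓝 0) := by
      refine squeeze_zero_norm' (a := fun θ => 2 * |ψ θ / θ|) ?_ ?_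
      · have hb : ∀ᶠ θ in 𝓝[>] (0 : ℝ), |ψ θ| ≤ 1 := by
          have := hψ0.abs
          rw [abs_zero] at this
          exact this.eventually_le_const one_pos
        filter_upwards [hb] with θ hθ
        rw [Real.norm_eq_abs, abs_div, abs_div, ← mul_div_assoc]
        gcongr
        exact Real.abs_exp_sub_one_le hθ
      · simpa using (hd.abs).const_mul 2
    have h0 : ∫ ω, X 1 ω ∂P ≤ 0 :=
      ge_of_tendsto hlim (eventually_nhdsWithin_of_forall hle)
    have hz : X 1 =ᵐ[P] 0 := (integral_eq_zero_iff_of_nonneg_ae hnn hint).1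
      (le_antisymm h0 (integral_nonneg_of_ae hnn))
    have h1 := (hψ 1 1 zero_le_one).2
    rw [integral_congr_ae (g := fun _ => (1 : ℝ)) (by
      filter_upwards [hz] with ω hω; simp [hω])] at h1
    have : 1 < Real.exp (ψ 1) := Real.one_lt_exp_iff.2 hpos
    simp at h1
    linarith
  · intro hm
    -- Decreasing paths would give E[e^{X_1}] ≤ 1, that is ψ(1) ≤ 0.
    have hnp : ∀ᵐ ω ∂P, X 1 ω ≤ 0 := by
      filter_upwards [hm, hX.start_zero] with ω h1 h2
      rw [← h2]; exact h1 zero_le_one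
    have h1 := hψ 1 1 zero_le_one
    have h2 := integral_mono_ae h1.1 (integrable_const 1) (by
      filter_upwards [hnp] with ω hω
      simpa using hω)
    rw [h1.2] at h2
    simp at h2
    linarith

theorem IsLevyProcess.add_drift (hX : IsLevyProcess X P) :
    IsLevyProcess (fun t ω => X t ω + t) P where
  isProbabilityMeasure := hX.isProbabilityMeasure
  measurable t := (hX.measurable t).add_const _
  cadlag ω t := by
    have hc : Continuous fun s : ℝ≥0 => (s : ℝ) := NNReal.continuous_coe
    obtain ⟨h1, l, hl⟩ := hX.cadlag ω t
    exact ⟨h1.add hc.continuousWithinAt, l + t, hl.add (hc.continuousWithinAt (s := Iio t))⟩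
  start_zero := by simpa using hX.start_zero
  indep_increments n t ht := by
    have := (hX.indep_increments n t ht).comp
      (fun i x => x + (((t i.succ : ℝ≥0) : ℝ) - t i.castSucc)) (fun i => by fun_prop)
    convert! this using 2 with i
    ext ω
    simp only [Function.comp]
    ring
  stationary_increments s t hst := by
    have h := congrArg (Measure.map (fun x : ℝ => x + (t - s : ℝ)))
      (hX.stationary_increments s t hst)
    rw [Measure.map_map (by fun_prop)
        (show Measurable fun ω => X t ω - X s ω from (hX.measurable t).sub (hX.measurable s)),
      Measure.map_map (by fun_prop) (hX.measurable _)] at h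
    convert h using 2 <;> ext ω <;> simp [NNReal.coe_sub hst]
    ring

theorem HasLevyTriplet.add_drift {μ σ : ℝ} {ν : Measure ℝ} (h : HasLevyTriplet X P μ σ ν) :
    HasLevyTriplet (fun t ω => X t ω + t) P (μ - 1) σ ν where
  no_mass_zero := h.no_mass_zero
  lintegral_lt_top := h.lintegral_lt_top
  exponent t θ := by
    have : ∀ ω, Complex.exp (Complex.I * θ * ((X t ω + t : ℝ) : ℂ)) =
        Complex.exp (Complex.I * θ * X t ω) * Complex.exp (Complex.I * θ * t) := fun ω => by
      rw [← Complex.exp_add]; push_cast; ring_nf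
    simp only [this]
    rw [integral_mul_const, h.exponent, ← Complex.exp_add]
    congr 1
    simp only [levyKhintchineExponent]
    push_cast
    ring

theorem HasLaplaceExponent.add_drift (hψ : HasLaplaceExponent X P ψ) :
    HasLaplaceExponent (fun t ω => X t ω + t) P (fun θ => ψ θ + θ) := by
  intro t l hl
  have : ∀ ω, Real.exp (l * (X t ω + t)) = Real.exp (l * X t ω) * Real.exp (l * t) := fun ω => by
    rw [← Real.exp_add]; ring_nf
  simp only [this]
  refine ⟨(hψ t l hl).1.mul_const _, ?_⟩
  rw [integral_mul_const, (hψ t l hl).2, ← Real.exp_add]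
  ring_nf

/-- If X_t + t had monotone paths, X would differ from a monotone path by a linear function and have
bounded variation. -/
theorem IsSpectrallyNegativeLevy.add_drift (hX : IsSpectrallyNegativeLevy X P)
    (hvar : ¬ HasBoundedVariationPaths X P) :
    IsSpectrallyNegativeLevy (fun t ω => X t ω + t) P where
  isLevyProcess := hX.isLevyProcess.add_drift
  jumps_neg := by
    obtain ⟨μ, σ, ν, h, hν⟩ := hX.jumps_neg
    exact ⟨μ - 1, σ, ν, h.add_drift, hν⟩
  not_monotone h := hvar <| by
    filter_upwards [h] with ω hω
    refine locallyBoundedVariationOn_of_monotone zero_le_one hω fun s t hst => ?_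
    have h1 := hω hst
    have h2 : (s : ℝ) ≤ t := hst
    rw [abs_le]
    constructor <;> simp only at h1 ⊢ <;> linarith
  not_antitone h := hvar <| by
    filter_upwards [h] with ω hω
    refine locallyBoundedVariationOn_of_monotone zero_le_one hω.neg fun s t hst => ?_
    have h1 := hω hst
    have h2 : (s : ℝ) ≤ t := hst
    rw [abs_le]
    constructor <;> simp only at h1 ⊢ <;> linarith

end LevyPaths

/-! ### Stieltjes functions and reciprocals of complete Bernstein functions -/

/-- `f` is, on `(0, ∞)`, a mixture of the kernels `θ ↦ (θ y + 1 - y)⁻¹`, `y ∈ [0, 1]`, by a finite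
measure; equivalently, a Stieltjes function. -/
def IsResolventMean (f : ℝ → ℝ) : Prop :=
  ∃ Q : Measure unitInterval, IsFiniteMeasure Q ∧
    ∀ θ, 0 < θ → f θ = ∫ y : unitInterval, (θ * (y : ℝ) + (1 - y))⁻¹ ∂Q

theorem resolventKernel_pos {θ : ℝ} (hθ : 0 < θ) (y : unitInterval) :
    0 < θ * (y : ℝ) + (1 - y) := by
  obtain ⟨y, h0, h1⟩ := y
  rcases h0.eq_or_lt with rfl | h
  · simp
  · have := mul_pos hθ h
    simp only; linarith

theorem continuous_resolventKernel {θ : ℝ} (hθ : 0 < θ) :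
    Continuous fun y : unitInterval => (θ * (y : ℝ) + (1 - y))⁻¹ :=
  Continuous.inv₀ (by fun_prop) fun y => (resolventKernel_pos hθ y).ne'

theorem integrable_resolventKernel (Q : Measure unitInterval) [IsFiniteMeasure Q] {θ : ℝ}
    (hθ : 0 < θ) : Integrable (fun y : unitInterval => (θ * (y : ℝ) + (1 - y))⁻¹) Q :=
  (BoundedContinuousFunction.mkOfCompact ⟨_, continuous_resolventKernel hθ⟩).integrable Q

theorem IsResolventMean.congr {f g : ℝ → ℝ} (hf : IsResolventMean f)
    (h : ∀ θ, 0 < θ → g θ = f θ) : IsResolventMean g := by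
  obtain ⟨Q, hQ, hf⟩ := hf
  exact ⟨Q, hQ, fun θ hθ => (h θ hθ).trans (hf θ hθ)⟩

/-- The point y = 1/(1+r) satisfies θy + 1 - y = (θ+r)/(1+r), which also explains the weight
c/(1+r). -/
theorem isResolventMean_const_mul_inv {c r : ℝ} (hc : 0 ≤ c) (hr : 0 ≤ r) :
    IsResolventMean fun θ => c * (θ + r)⁻¹ := by
  have hr1 : 0 < 1 + r := by linarith
  refine ⟨ENNReal.ofReal (c / (1 + r)) • Measure.dirac
    ⟨(1 + r)⁻¹, by positivity, inv_le_one_of_one_le₀ (by linarith)⟩,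
    Measure.smul_finite _ ENNReal.ofReal_ne_top, fun θ hθ => ?_⟩
  rw [integral_smul_measure, integral_dirac, ENNReal.toReal_ofReal (by positivity), smul_eq_mul]
  have : 0 < θ + r := by linarith
  have h2 : θ * (1 + r)⁻¹ + (1 - (1 + r)⁻¹) = (θ + r) / (1 + r) := by field_simp; ring
  rw [h2]
  field_simp

theorem isResolventMean_sum {ι : Type*} (s : Finset ι) {f : ι → ℝ → ℝ}
    (h : ∀ i, IsResolventMean (f i)) : IsResolventMean fun θ => ∑ i ∈ s, f i θ := by
  choose Q hQ hf using h
  refine ⟨∑ i ∈ s, Q i, inferInstance, fun θ hθ => ?_⟩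
  rw [integral_finsetSum_measure fun i _ => integrable_resolventKernel (Q i) hθ]
  exact Finset.sum_congr rfl fun i _ => hf i θ hθ

/-- Resolvent means are closed under pointwise limits. -/
theorem isResolventMean_of_tendsto {f : ℕ → ℝ → ℝ} {g : ℝ → ℝ}
    (hf : ∀ n, IsResolventMean (f n))
    (hlim : ∀ θ, 0 < θ → Tendsto (fun n => f n θ) atTop (𝓝 (g θ))) : IsResolventMean g := by
  choose Q hQ hf using hf
  -- At θ = 1 the kernel is identically 1, so convergence there bounds the masses.
  have hmass : ∀ n, (Q n).real univ = f n 1 := fun n => by rw [hf n 1 one_pos]; simp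
  obtain ⟨C, hC⟩ := (hlim 1 one_pos).bddAbove_range
  let q : ℕ → FiniteMeasure unitInterval := fun n => ⟨Q n, hQ n⟩
  have hQC : ∀ n, q n ∈
      {μ : FiniteMeasure unitInterval | μ.mass ≤ C.toNNReal} := fun n => by
    have h1 : (Q n).real univ ≤ C := by rw [hmass]; exact hC (mem_range_self n)
    change ((Q n) univ).toNNReal ≤ C.toNNReal
    exact Real.toNNReal_le_toNNReal h1 |>.trans' (by simp [Measure.real, Real.toNNReal_coe, ENNReal.toReal])
  -- Measures of bounded mass on the compact interval [0, 1] form a weakly compact set; the limit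
  -- along a free ultrafilter replaces a convergent subsequence. The kernels are continuous test
  -- functions even at the two ends.
  let F : Ultrafilter (FiniteMeasure unitInterval) :=
    (hyperfilter ℕ).map q
  have hF : (F : Filter (FiniteMeasure unitInterval)) ≤
      𝓟 {μ : FiniteMeasure unitInterval | μ.mass ≤ C.toNNReal} := by
    rw [le_principal_iff]
    exact Filter.mem_map.2 (univ_mem' hQC)
  obtain ⟨R, -, hR⟩ :=
    (isCompact_setOfPred_finiteMeasure_le_of_compactSpace unitInterval C.toNNReal).ultrafilter_le_nhds
      F hF
  refine ⟨R, inferInstance, fun θ hθ => ?_⟩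
  have h1 : Tendsto q (hyperfilter ℕ) (𝓝 R) :=
    hR
  have h2 := (FiniteMeasure.tendsto_iff_forall_integral_tendsto.1 h1)
    (BoundedContinuousFunction.mkOfCompact ⟨_, continuous_resolventKernel hθ⟩)
  have h3 := (hlim θ hθ).mono_left (Nat.hyperfilter_le_atTop)
  refine tendsto_nhds_unique h3 (h2.congr fun n => ?_)
  exact (hf n θ hθ).symm

open Matrix in
/-- Diagonal entries of the resolvent of a positive semidefinite matrix are resolvent means. -/
theorem isResolventMean_of_posSemidef {n : Type*} [Fintype n] [DecidableEq n]
    {M : Matrix n n ℝ} (hM : M.PosSemidef) (e : n → ℝ) (v : ℝ → n → ℝ)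
    (hv : ∀ θ, 0 < θ → M *ᵥ v θ + θ • v θ = e) : IsResolventMean fun θ => e ⬝ᵥ v θ := by
  set w : n → n → ℝ := fun j => (hM.1.eigenvectorBasis j).ofLp with hw
  have hpars : ∀ x y : n → ℝ, x ⬝ᵥ y = ∑ j, (x ⬝ᵥ w j) * (w j ⬝ᵥ y) := by
    intro x y
    have := hM.1.eigenvectorBasis.sum_inner_mul_inner (WithLp.toLp 2 x) (WithLp.toLp 2 y)
    simp only [EuclideanSpace.inner_eq_star_dotProduct, star_trivial] at this
    rw [dotProduct_comm, ← this]
    exact Finset.sum_congr rfl fun j _ => by rw [dotProduct_comm x, dotProduct_comm (w j) y]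
  -- In an orthonormal eigenbasis the quantity is Σ_j (e·w_j)²/(θ + λ_j) with λ_j ≥ 0.
  refine (isResolventMean_sum Finset.univ fun j =>
    isResolventMean_const_mul_inv (sq_nonneg (e ⬝ᵥ w j)) (hM.eigenvalues_nonneg j)).congr
    fun θ hθ => ?_
  rw [hpars]
  refine Finset.sum_congr rfl fun j _ => ?_
  have hpos : 0 < θ + hM.1.eigenvalues j := by linarith [hM.eigenvalues_nonneg j]
  have h1 : w j ⬝ᵥ (M *ᵥ v θ) = hM.1.eigenvalues j * (w j ⬝ᵥ v θ) := by
    have hT : Mᵀ = M := (show M.IsSymm by simpa using hM.1).eq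
    rw [dotProduct_mulVec, ← mulVec_transpose, hT, hw]
    simp only
    rw [hM.1.mulVec_eigenvectorBasis j, smul_dotProduct, smul_eq_mul]
  have h2 : e ⬝ᵥ w j = (θ + hM.1.eigenvalues j) * (w j ⬝ᵥ v θ) := by
    rw [dotProduct_comm]
    nth_rewrite 1 [← hv θ hθ]
    rw [dotProduct_add, h1, dotProduct_smul, smul_eq_mul]
    ring
  rw [h2]
  field_simp

open Matrix in
/-- The reciprocal of a rational complete Bernstein function is a Stieltjes function. -/
theorem isResolventMean_inv_of_sum {ι : Type*} [Fintype ι] {c κ : ℝ} (hc : 0 < c)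
    (hκ : 0 < κ) {w s : ι → ℝ} (hw : ∀ i, 0 ≤ w i) (hs : ∀ i, 0 ≤ s i) :
    IsResolventMean fun θ => (c + κ * θ + ∑ i, w i * (θ * s i / (θ + s i)))⁻¹ := by
  classical
  -- Since wθs/(θ+s) = ws - ws²/(θ+s), the function divided by κ is θ + a - Σ b_i²/(θ + s_i). This
  -- is the Schur complement of the `none` entry in θ + M, with M the arrow matrix of corner a,
  -- border b and diagonal s, so the reciprocal is 1/κ times a diagonal resolvent entry.
  set b : ι → ℝ := fun i => s i * √(w i / κ) with hb
  set a : ℝ := (c + ∑ i, w i * s i) / κ with ha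
  have hb2 : ∀ i, b i ^ 2 = w i * s i ^ 2 / κ := fun i => by
    rw [hb]; simp only; rw [mul_pow, Real.sq_sqrt (div_nonneg (hw i) hκ.le)]; ring
  let M : Matrix (Option ι) (Option ι) ℝ := fun p q => match p, q with
    | none, none => a
    | none, some i => b i
    | some i, none => b i
    | some i, some j => if i = j then s i else 0
  have hmul0 : ∀ x : Option ι → ℝ, (M *ᵥ x) none = a * x none + ∑ i, b i * x (some i) := by
    intro x; simp [mulVec, dotProduct, Fintype.sum_option, M]
  have hmul1 : ∀ (x : Option ι → ℝ) i, (M *ᵥ x) (some i) = b i * x none + s i * x (some i) := by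
    intro x i; simp [mulVec, dotProduct, Fintype.sum_option, M]
  have hM : M.PosSemidef := by
    refine .of_dotProduct_mulVec_nonneg ?_ fun x => ?_
    · ext p q
      rw [conjTranspose_apply, star_trivial]
      rcases p with _ | i <;> rcases q with _ | j
      · rfl
      · rfl
      · rfl
      · change (if j = i then s j else 0) = if i = j then s i else 0
        by_cases h : i = j
        · simp [h]
        · rw [if_neg h, if_neg (Ne.symm h)]
    · simp only [star_trivial, dotProduct, Fintype.sum_option, hmul0, hmul1]
      -- Completing squares shows the quadratic form of M to be nonnegative.
      have : x none * (a * x none + ∑ i, b i * x (some i)) +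
          ∑ i, x (some i) * (b i * x none + s i * x (some i)) =
          c / κ * x none ^ 2 + ∑ i, s i * (√(w i / κ) * x none + x (some i)) ^ 2 := by
        have h1 : ∀ i, s i * (√(w i / κ) * x none + x (some i)) ^ 2 =
            w i * s i * (x none ^ 2 / κ) + x none * (b i * x (some i)) +
            x (some i) * (b i * x none + s i * x (some i)) := fun i => by
          have := Real.sq_sqrt (div_nonneg (hw i) hκ.le)
          rw [hb]; simp only
          rw [add_sq, mul_pow, this]; ring
        simp only [h1, Finset.sum_add_distrib, ← Finset.sum_mul, ← Finset.mul_sum]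
        rw [ha]; ring
      rw [this]
      refine add_nonneg (by positivity) (Finset.sum_nonneg fun i _ => ?_)
      exact mul_nonneg (hs i) (sq_nonneg _)
  set G : ℝ → ℝ := fun θ => c + κ * θ + ∑ i, w i * (θ * s i / (θ + s i)) with hG
  have hGpos : ∀ θ, 0 < θ → 0 < G θ := fun θ hθ => by
    have : 0 ≤ ∑ i, w i * (θ * s i / (θ + s i)) := Finset.sum_nonneg fun i _ =>
      mul_nonneg (hw i) (div_nonneg (mul_nonneg hθ.le (hs i)) (add_nonneg hθ.le (hs i)))
    rw [hG]; simp only; positivity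
  -- The solution of (θ + M)v = e by elimination of the lower block. The factor 1/√κ in e supplies
  -- the missing 1/κ in e·v.
  let v : ℝ → Option ι → ℝ := fun θ p => match p with
    | none => √κ * (G θ)⁻¹
    | some i => - (b i / (θ + s i)) * (√κ * (G θ)⁻¹)
  let e : Option ι → ℝ := fun p => match p with
    | none => (√κ)⁻¹
    | some _ => 0
  have hsκ : √κ ≠ 0 := (Real.sqrt_pos.2 hκ).ne'
  refine (isResolventMean_of_posSemidef hM e v fun θ hθ => ?_).congr fun θ hθ => ?_
  · ext p
    rcases p with _ | i
    · simp only [Pi.add_apply, hmul0, Pi.smul_apply, smul_eq_mul, v, e]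
      have h1 : ∑ i, b i * (-(b i / (θ + s i)) * (√κ * (G θ)⁻¹)) =
          -(∑ i, w i * s i ^ 2 / (θ + s i)) / κ * (√κ * (G θ)⁻¹) := by
        rw [← Finset.sum_neg_distrib, Finset.sum_div, Finset.sum_mul]
        refine Finset.sum_congr rfl fun i _ => ?_
        have : b i * (-(b i / (θ + s i)) * (√κ * (G θ)⁻¹)) =
          - (b i ^ 2) / (θ + s i) * (√κ * (G θ)⁻¹) := by ring
        rw [this, hb2]; ring
      have h2 : G θ = κ * (a + θ - (∑ i, w i * s i ^ 2 / (θ + s i)) / κ) := by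
        have h3 : ∀ i, w i * (θ * s i / (θ + s i)) = w i * s i - w i * s i ^ 2 / (θ + s i) :=
          fun i => by
            have : 0 < θ + s i := add_pos_of_pos_of_nonneg hθ (hs i)
            field_simp; ring
        rw [hG]; simp only [h3, Finset.sum_sub_distrib]
        rw [ha]; field_simp; ring
      have h4 := hGpos θ hθ
      have h5 : √κ * √κ = κ := Real.mul_self_sqrt hκ.le
      rw [h1]
      have : a * (√κ * (G θ)⁻¹) + -(∑ i, w i * s i ^ 2 / (θ + s i)) / κ * (√κ * (G θ)⁻¹) +
          θ * (√κ * (G θ)⁻¹) =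
          (κ * (a + θ - (∑ i, w i * s i ^ 2 / (θ + s i)) / κ)) * (√κ / κ * (G θ)⁻¹) := by
        field_simp; ring
      rw [this, ← h2, mul_left_comm, mul_inv_cancel₀ h4.ne', mul_one]
      field_simp
      rw [sq, h5]
    · have : 0 < θ + s i := add_pos_of_pos_of_nonneg hθ (hs i)
      simp only [Pi.add_apply, hmul1, Pi.smul_apply, smul_eq_mul, v, e]
      field_simp
      ring
  · simp only [dotProduct, Fintype.sum_option, e, v, zero_mul, Finset.sum_const_zero, add_zero]
    rw [← mul_assoc, inv_mul_cancel₀ hsκ, one_mul]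

theorem ae_pos_of_measure_Iic_eq_zero {U : Measure ℝ} (hU : U (Iic 0) = 0) :
    ∀ᵐ x ∂U, 0 < x := by
  rw [ae_iff]; simpa [Iic, not_lt] using hU

theorem integrable_min_one {U : Measure ℝ} (hU : U (Iic 0) = 0)
    (hfin : ∫⁻ x, ENNReal.ofReal (min 1 x) ∂U < ∞) : Integrable (fun x : ℝ => min 1 x) U := by
  refine ⟨by fun_prop, ?_⟩
  rw [hasFiniteIntegral_iff_ofReal]
  · exact hfin
  · filter_upwards [ae_pos_of_measure_Iic_eq_zero hU] with x hx
    exact le_min zero_le_one hx.le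

/-- Needed for Fubini. The weight min(1, x) makes the measure finite and is a.e. positive, so it can
be divided out again. -/
theorem sFinite_of_lintegral_min_one {U : Measure ℝ} (hU : U (Iic 0) = 0)
    (hfin : ∫⁻ x, ENNReal.ofReal (min 1 x) ∂U < ∞) : SFinite U := by
  have h1 : IsFiniteMeasure (U.withDensity fun x => ENNReal.ofReal (min 1 x)) :=
    isFiniteMeasure_withDensity hfin.ne
  rw [← withDensity_inv_same (μ := U) (f := fun x => ENNReal.ofReal (min 1 x)) (by fun_prop) ?_
    (ae_of_all _ fun x => ENNReal.ofReal_ne_top)]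
  · infer_instance
  · filter_upwards [ae_pos_of_measure_Iic_eq_zero hU] with x hx
    simpa using hx

theorem mul_div_add_le {θ x : ℝ} (hθ : 0 < θ) (hx : 0 ≤ x) :
    θ * x / (θ + x) ≤ (1 + θ) * min 1 x := by
  have h : 0 < θ + x := by linarith
  rw [div_le_iff₀ h]
  rcases min_cases 1 x with ⟨h1, h2⟩ | ⟨h1, h2⟩ <;> rw [h1]
  · nlinarith
  · nlinarith [mul_nonneg hx hx, mul_nonneg hθ.le hx, mul_nonneg (mul_nonneg hθ.le hx) hθ.le,
      mul_nonneg (mul_nonneg hθ.le hx) hx]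

theorem mul_div_add_mono {θ x y : ℝ} (hθ : 0 < θ) (hx : 0 ≤ x) (hxy : x ≤ y) :
    θ * x / (θ + x) ≤ θ * y / (θ + y) := by
  rw [div_le_div_iff₀ (by linarith) (by linarith)]
  nlinarith [mul_nonneg hθ.le hθ.le]

theorem integrable_mul_div_add {U : Measure ℝ} (hU : U (Iic 0) = 0)
    (hfin : ∫⁻ x, ENNReal.ofReal (min 1 x) ∂U < ∞) {θ : ℝ} (hθ : 0 < θ) :
    Integrable (fun x : ℝ => θ * x / (θ + x)) U := by
  refine ((integrable_min_one hU hfin).const_mul (1 + θ)).mono'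
    (Measurable.aestronglyMeasurable (by fun_prop)) ?_
  filter_upwards [ae_pos_of_measure_Iic_eq_zero hU] with x hx
  rw [Real.norm_of_nonneg (by positivity)]
  exact mul_div_add_le hθ hx.le

/-- The reciprocal of a complete Bernstein function is a Stieltjes function. -/
theorem isResolventMean_inv_of_integral {c κ : ℝ} (hc : 0 < c) (hκ : 0 ≤ κ) {U : Measure ℝ}
    (hU : U (Iic 0) = 0) (hfin : ∫⁻ x, ENNReal.ofReal (min 1 x) ∂U < ∞) :
    IsResolventMean fun θ => (c + κ * θ + ∫ x, θ * x / (θ + x) ∂U)⁻¹ := by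
  have hpos := ae_pos_of_measure_Iic_eq_zero hU
  set A : ℕ → ℕ → Set ℝ := fun n k => {x | ⌊((n : ℝ) + 1) * x⌋₊ = k} with hA
  have hAm : ∀ n k, MeasurableSet (A n k) := fun n k =>
    measurableSet_eq_fun (by fun_prop) measurable_const
  have hmono : ∀ (n : ℕ) {x : ℝ}, 0 < x → (⌊((n : ℝ) + 1) * x⌋₊ : ℝ) / (n + 1) ≤ x := by
    intro n x hx
    rw [div_le_iff₀ (by positivity), mul_comm x]
    exact Nat.floor_le (by positivity)
  -- Riemann sums of mesh 1/(n+1), with (n+1)² + 1 cells so that they also exhaust (0, ∞). The extra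
  -- 1/(n+1) makes the coefficient of θ positive, as the rational case requires.
  refine isResolventMean_of_tendsto (f := fun n θ => (c + (κ + 1 / ((n : ℝ) + 1)) * θ +
    ∑ k : Fin ((n + 1) ^ 2 + 1),
      U.real (A n k) * (θ * ((k : ℝ) / (n + 1)) / (θ + (k : ℝ) / (n + 1))))⁻¹)
    (fun n => isResolventMean_inv_of_sum hc (by positivity) (fun k => measureReal_nonneg)
      fun k => by positivity) fun θ hθ => ?_
  set h : ℝ → ℝ := fun x => θ * x / (θ + x) with hh
  have hint := integrable_mul_div_add hU hfin hθ
  -- Cell `k = 0` may have infinite mass, for which `U.real` is 0; this is harmless because its node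
  -- is 0 and h(0) = 0.
  have hsum : ∀ n : ℕ, ∑ k : Fin ((n + 1) ^ 2 + 1), U.real (A n k) * h ((k : ℝ) / (n + 1)) =
      ∫ x, ∑ k : Fin ((n + 1) ^ 2 + 1),
        (A n k).indicator (fun _ => h ((k : ℝ) / (n + 1))) x ∂U := by
    intro n
    rw [integral_finsetSum]
    · refine Finset.sum_congr rfl fun k _ => ?_
      rw [integral_indicator_const _ (hAm n k), smul_eq_mul]
    · intro k _
      refine hint.mono' ((measurable_const.indicator (hAm n k)).aestronglyMeasurable) ?_
      filter_upwards [hpos] with x hx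
      by_cases hxk : x ∈ A n k
      · rw [indicator_of_mem hxk, Real.norm_of_nonneg (by rw [hh]; positivity)]
        have := hmono n hx
        rw [show ⌊((n : ℝ) + 1) * x⌋₊ = k from hxk] at this
        exact mul_div_add_mono hθ (by positivity) this
      · rw [indicator_of_notMem hxk, norm_zero]
        positivity
  have hval : ∀ (n : ℕ) (x : ℝ), ∑ k : Fin ((n + 1) ^ 2 + 1),
      (A n k).indicator (fun _ => h ((k : ℝ) / (n + 1))) x =
      if ⌊((n : ℝ) + 1) * x⌋₊ < (n + 1) ^ 2 + 1 then
        h ((⌊((n : ℝ) + 1) * x⌋₊ : ℝ) / (n + 1)) else 0 := by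
    intro n x
    rw [Fin.sum_univ_eq_sum_range
      (fun k => (A n k).indicator (fun _ => h ((k : ℝ) / (n + 1))) x)]
    simp only [hA, indicator, mem_ofPred_eq]
    rw [Finset.sum_ite_eq]
    simp only [Finset.mem_range]
  have hlim : Tendsto (fun n : ℕ => ∑ k : Fin ((n + 1) ^ 2 + 1),
      U.real (A n k) * h ((k : ℝ) / (n + 1))) atTop (𝓝 (∫ x, h x ∂U)) := by
    simp only [hsum, hval]
    refine tendsto_integral_of_dominated_convergence h (fun n => ?_) hint (fun n => ?_) ?_
    · refine (Measurable.ite (measurableSet_lt (by fun_prop) measurable_const) ?_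
        measurable_const).aestronglyMeasurable
      rw [hh]; fun_prop
    · filter_upwards [hpos] with x hx
      split_ifs with hk
      · rw [Real.norm_of_nonneg (by rw [hh]; positivity)]
        exact mul_div_add_mono hθ (by positivity) (hmono n hx)
      · rw [norm_zero, hh]; positivity
    · filter_upwards [hpos] with x hx
      have hfl : Tendsto (fun n : ℕ => (⌊((n : ℝ) + 1) * x⌋₊ : ℝ) / (n + 1)) atTop (𝓝 x) := by
        have h1 := (tendsto_nat_floor_mul_div_atTop (R := ℝ) hx.le).comp
          (tendsto_natCast_atTop_atTop.atTop_add (tendsto_const_nhds (x := (1 : ℝ))))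
        refine h1.congr fun n => ?_
        simp [mul_comm]
      have hcont : ContinuousAt h x :=
        ContinuousAt.div (by fun_prop) (by fun_prop) (by positivity)
      refine (hcont.tendsto.comp hfl).congr' ?_
      filter_upwards [eventually_ge_atTop ⌈x⌉₊] with n hn
      have hxn : x ≤ n := (Nat.le_ceil x).trans (by exact_mod_cast hn)
      rw [if_pos]
      · rfl
      · rw [Nat.lt_succ_iff]
        refine Nat.floor_le_of_le ?_
        push_cast
        nlinarith
  have hκlim : Tendsto (fun n : ℕ => c + (κ + 1 / ((n : ℝ) + 1)) * θ) atTop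
      (𝓝 (c + κ * θ)) := by
    have := ((tendsto_one_div_add_atTop_nhds_zero_nat (𝕜 := ℝ)).const_add κ).mul_const θ
    simpa using this.const_add c
  refine (hκlim.add hlim).inv₀ (ne_of_gt ?_)
  have : 0 ≤ ∫ x, h x ∂U := integral_nonneg_of_ae <| by
    filter_upwards [hpos] with x hx
    rw [hh]; simp only [Pi.zero_apply]; positivity
  positivity

/-! ### Stieltjes measures and Laplace densities -/

theorem integral_exp_neg_mul_Ioi {θ : ℝ} (hθ : 0 < θ) :
    ∫ x in Ioi (0 : ℝ), Real.exp (-θ * x) = 1 / θ := by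
  rw [integral_exp_mul_Ioi (by linarith)]
  simp

theorem integrableOn_exp_neg_mul_Ioi {θ : ℝ} (hθ : 0 < θ) :
    IntegrableOn (fun x => Real.exp (-θ * x)) (Ioi 0) :=
  integrableOn_exp_mul_Ioi (by linarith) 0

theorem integrableOn_mul_exp_neg_mul_Ioi {θ : ℝ} (hθ : 0 < θ) :
    IntegrableOn (fun x => x * Real.exp (-θ * x)) (Ioi 0) := by
  have := integrableOn_rpow_mul_exp_neg_mul_rpow (p := 1) (s := 1) (b := θ) (by norm_num)
    one_pos hθ
  simpa using this

theorem integral_mul_exp_neg_mul_Ioi {θ : ℝ} (hθ : 0 < θ) :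
    ∫ x in Ioi (0 : ℝ), x * Real.exp (-θ * x) = 1 / θ ^ 2 := by
  have := Real.integral_rpow_mul_exp_neg_mul_Ioi (a := 2) (r := θ) (by norm_num) hθ
  rw [show (2 : ℝ) - 1 = 1 by norm_num] at this
  simpa using this

/-- The Stieltjes-type representation of a complete Bernstein function. -/
theorem IsCompleteBernstein.exists_integral {φ : ℝ → ℝ} (hφ : IsCompleteBernstein φ) :
    ∃ (c κ : ℝ) (U : Measure ℝ), 0 ≤ c ∧ 0 ≤ κ ∧ U (Iic 0) = 0 ∧
      ∫⁻ x, ENNReal.ofReal (min 1 x) ∂U < ∞ ∧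
      ∀ θ, 0 < θ → φ θ = c + κ * θ + ∫ x, θ * x / (θ + x) ∂U := by
  obtain ⟨η, ⟨κ, δ, U, hκ, hδ, hU, hfin, hη⟩, hφ⟩ := hφ
  -- The constants change roles: θ² times the Laplace transform of κ + δx is κθ + δ.
  refine ⟨δ, κ, U, hδ, hκ, hU, hfin, fun θ hθ => ?_⟩
  have hsf := sFinite_of_lintegral_min_one hU hfin
  have hpos := ae_pos_of_measure_Iic_eq_zero hU
  have hinner : ∀ s : ℝ, 0 < s → ∫ x in Ioi (0 : ℝ),
      Real.exp (-θ * x) * (1 - Real.exp (-x * s)) = (θ * s / (θ + s)) / θ ^ 2 := by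
    intro s hs
    have h1 : ∀ x, Real.exp (-θ * x) * (1 - Real.exp (-x * s)) =
        Real.exp (-θ * x) - Real.exp (-(θ + s) * x) := fun x => by
      rw [mul_sub, mul_one, ← Real.exp_add]; ring_nf
    simp only [h1]
    rw [integral_sub (integrableOn_exp_neg_mul_Ioi hθ)
      (integrableOn_exp_neg_mul_Ioi (by linarith)), integral_exp_neg_mul_Ioi hθ,
      integral_exp_neg_mul_Ioi (by linarith)]
    field_simp
    ring
  have hinnerint : ∀ s : ℝ, 0 < s → IntegrableOn (fun x =>
      Real.exp (-θ * x) * (1 - Real.exp (-x * s))) (Ioi 0) := by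
    intro s hs
    have h1 : ∀ x, Real.exp (-θ * x) * (1 - Real.exp (-x * s)) =
        Real.exp (-θ * x) - Real.exp (-(θ + s) * x) := fun x => by
      rw [mul_sub, mul_one, ← Real.exp_add]; ring_nf
    simp only [h1]
    exact (integrableOn_exp_neg_mul_Ioi hθ).sub (integrableOn_exp_neg_mul_Ioi (by linarith))
  have hprod : Integrable (Function.uncurry fun x s =>
      Real.exp (-θ * x) * (1 - Real.exp (-x * s))) ((volume.restrict (Ioi (0 : ℝ))).prod U) := by
    rw [integrable_prod_iff' (Measurable.aestronglyMeasurable (by fun_prop))]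
    refine ⟨?_, ?_⟩
    · filter_upwards [hpos] with s hs using hinnerint s hs
    · refine ((integrable_mul_div_add hU hfin hθ).div_const (θ ^ 2)).congr ?_
      filter_upwards [hpos] with s hs
      rw [← hinner s hs]
      refine setIntegral_congr_fun measurableSet_Ioi fun x hx => ?_
      simp only [Function.uncurry]
      rw [Real.norm_of_nonneg]
      have : Real.exp (-x * s) ≤ 1 := Real.exp_le_one_iff.2 (by nlinarith [mem_Ioi.1 hx])
      exact mul_nonneg (Real.exp_pos _).le (by linarith)
  have hswap := integral_integral_swap hprod
  have hint1 : IntegrableOn (fun x => ∫ s, Real.exp (-θ * x) * (1 - Real.exp (-x * s)) ∂U)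
      (Ioi 0) := hprod.integral_prod_left
  rw [hφ θ hθ]
  have hsplit : ∀ x ∈ Ioi (0 : ℝ), Real.exp (-θ * x) * η x =
      κ * Real.exp (-θ * x) + δ * (x * Real.exp (-θ * x)) +
      ∫ s, Real.exp (-θ * x) * (1 - Real.exp (-x * s)) ∂U := by
    intro x hx
    rw [integral_const_mul, hη x (le_of_lt hx)]
    ring
  rw [setIntegral_congr_fun measurableSet_Ioi hsplit]
  have e1 := (integrableOn_exp_neg_mul_Ioi hθ).const_mul κ
  have e2 := (integrableOn_mul_exp_neg_mul_Ioi hθ).const_mul δ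
  have e12 : IntegrableOn (fun x => κ * Real.exp (-θ * x) + δ * (x * Real.exp (-θ * x))) (Ioi 0) :=
    e1.add e2
  rw [integral_add e12 hint1, integral_add e1 e2, integral_const_mul, integral_const_mul,
    hswap, integral_exp_neg_mul_Ioi hθ, integral_mul_exp_neg_mul_Ioi hθ]
  rw [integral_congr_ae (g := fun s => (θ * s / (θ + s)) / θ ^ 2)
    (by filter_upwards [hpos] with s hs using hinner s hs), integral_div]
  field_simp
  ring

/-- A bounded Stieltjes function that vanishes at infinity is the Stieltjes transform of a measure
on `(0, ∞)`. -/
theorem IsResolventMean.exists_stieltjes_measure {g : ℝ → ℝ} (hg : IsResolventMean g)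
    (hinf : ∀ ε > 0, ∃ θ, 0 < θ ∧ g θ < ε) {B : ℝ} (hB : ∀ θ, 0 < θ → g θ ≤ B) :
    ∃ m : Measure ℝ, SFinite m ∧ m (Iic 0) = 0 ∧ ∀ θ, 0 < θ →
      Integrable (fun s => (θ + s)⁻¹) m ∧ ∫ s, (θ + s)⁻¹ ∂m = g θ := by
  obtain ⟨Q, hQ, hg⟩ := hg
  -- An atom at y = 0 would keep g above a positive constant. An atom at y = 1 would add a multiple
  -- of 1/θ, which exceeds the bound B for small θ.
  have hsingle : ∀ (y : unitInterval) (θ : ℝ), 0 < θ →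
      Q.real {y} * (θ * (y : ℝ) + (1 - y))⁻¹ ≤ g θ := by
    intro y θ hθ
    have h := integral_singleton (μ := Q) (fun z : unitInterval => (θ * (z : ℝ) + (1 - z))⁻¹) y
    rw [smul_eq_mul] at h
    rw [hg θ hθ, ← h]
    exact setIntegral_le_integral (integrable_resolventKernel Q hθ)
      (ae_of_all _ fun z => inv_nonneg.2 (resolventKernel_pos hθ z).le)
  have h0 : Q {0} = 0 := by
    rw [← measureReal_eq_zero_iff]
    by_contra hne
    have hpos : 0 < Q.real {0} := lt_of_le_of_ne measureReal_nonneg (Ne.symm hne)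
    obtain ⟨θ, hθ, hlt⟩ := hinf _ hpos
    have := hsingle 0 θ hθ
    simp at this
    linarith
  have h1 : Q {1} = 0 := by
    rw [← measureReal_eq_zero_iff]
    by_contra hne
    have hpos : 0 < Q.real {1} := lt_of_le_of_ne measureReal_nonneg (Ne.symm hne)
    have hBpos : 0 < |B| + 1 := by positivity
    have h2 := (hsingle 1 (Q.real {1} / (|B| + 1)) (by positivity)).trans (hB _ (by positivity))
    simp only [Icc.coe_one, mul_one, sub_self, add_zero, inv_div] at h2
    rw [mul_div_cancel₀ _ hpos.ne'] at h2
    linarith [le_abs_self B]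
  have hae : ∀ᵐ y : unitInterval ∂Q, 0 < (y : ℝ) ∧ (y : ℝ) < 1 := by
    have a0 : ∀ᵐ y ∂Q, y ≠ 0 := by rw [ae_iff]; simpa using h0
    have a1 : ∀ᵐ y ∂Q, y ≠ 1 := by rw [ae_iff]; simpa using h1
    filter_upwards [a0, a1] with y hy0 hy1
    exact ⟨unitInterval.pos_iff_ne_zero.2 hy0, unitInterval.lt_one_iff_ne_one.2 hy1⟩
  -- Change of variable s = (1-y)/y with density 1/y, because θy + 1 - y = y(θ + s).
  have hT : Measurable fun y : unitInterval => (1 - (y : ℝ)) / y := by fun_prop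
  have hd : Measurable fun y : unitInterval => ((y : ℝ)⁻¹).toNNReal := by fun_prop
  have hT' : AEMeasurable (fun y : unitInterval => (1 - (y : ℝ)) / y)
    (Q.withDensity fun y => (((y : ℝ)⁻¹).toNNReal : ℝ≥0∞)) := hT.aemeasurable
  have hker : ∀ θ : ℝ, 0 < θ → ∀ y : unitInterval, 0 < (y : ℝ) →
      ((y : ℝ)⁻¹).toNNReal • (θ + (1 - (y : ℝ)) / y)⁻¹ = (θ * (y : ℝ) + (1 - y))⁻¹ := by
    intro θ hθ y hy
    have := resolventKernel_pos hθ y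
    rw [NNReal.smul_def, Real.coe_toNNReal _ (by positivity), smul_eq_mul, ← mul_inv]
    congr 1
    field_simp
  refine ⟨(Q.withDensity fun y => (((y : ℝ)⁻¹).toNNReal : ℝ≥0∞)).map
    (fun y : unitInterval => (1 - (y : ℝ)) / y), inferInstance, ?_, fun θ hθ => ?_⟩
  · rw [Measure.map_apply hT measurableSet_Iic]
    refine withDensity_absolutelyContinuous _ _ ?_
    rw [← compl_compl ((fun y : unitInterval => (1 - (y : ℝ)) / y) ⁻¹' Iic 0)]
    refine mem_ae_iff.1 ?_
    filter_upwards [hae] with y hy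
    simp only [mem_compl_iff, mem_preimage, mem_Iic, not_le]
    exact div_pos (by linarith) hy.1
  · have hm : Measurable fun s : ℝ => (θ + s)⁻¹ := by fun_prop
    constructor
    · rw [integrable_map_measure hm.aestronglyMeasurable hT',
        integrable_withDensity_iff_integrable_smul hd]
      refine (integrable_resolventKernel Q hθ).congr ?_
      filter_upwards [hae] with y hy using (hker θ hθ y hy.1).symm
    · rw [integral_map hT' hm.aestronglyMeasurable, integral_withDensity_eq_integral_smul hd,
        hg θ hθ]
      refine integral_congr_ae ?_
      filter_upwards [hae] with y hy using hker θ hθ y hy.1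

/-- A bounded Stieltjes function that vanishes at infinity is the Laplace transform of a continuous
decreasing function on `(0, ∞)` that vanishes at infinity. -/
theorem IsResolventMean.exists_laplace_density {g : ℝ → ℝ} (hg : IsResolventMean g)
    (hinf : ∀ ε > 0, ∃ θ, 0 < θ ∧ g θ < ε) {B : ℝ} (hB : ∀ θ, 0 < θ → g θ ≤ B) :
    ∃ u : ℝ → ℝ, (∀ x, 0 ≤ u x) ∧ AntitoneOn u (Ioi 0) ∧ ContinuousOn u (Ioi 0) ∧
      Tendsto u atTop (𝓝 0) ∧ ∀ θ, 0 < θ →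
        IntegrableOn (fun x => Real.exp (-θ * x) * u x) (Ioi 0) ∧
        ∫ x in Ioi 0, Real.exp (-θ * x) * u x = g θ := by
  obtain ⟨m, hsf, hm0, hm⟩ := hg.exists_stieltjes_measure hinf hB
  have hpos := ae_pos_of_measure_Iic_eq_zero hm0
  -- One dominating function for all x ≥ a. It is integrable in s because the Stieltjes transform is
  -- finite at 1/a, and it serves for integrability, continuity and the limit at infinity.
  have hle : ∀ {a x s : ℝ}, 0 < a → a ≤ x → 0 < s →
      Real.exp (-(s * x)) ≤ a⁻¹ * (a⁻¹ + s)⁻¹ := by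
    intro a x s ha hx hs
    have h1 : a⁻¹ * (a⁻¹ + s)⁻¹ = (1 + s * a)⁻¹ := by field_simp
    rw [h1, Real.exp_neg]
    refine inv_anti₀ (by positivity) ?_
    have := Real.add_one_le_exp (s * x)
    nlinarith
  have hint : ∀ x : ℝ, 0 < x → Integrable (fun s => Real.exp (-(s * x))) m := by
    intro x hx
    refine ((hm x⁻¹ (by positivity)).1.const_mul x⁻¹).mono' (by fun_prop) ?_
    filter_upwards [hpos] with s hs
    rw [Real.norm_of_nonneg (Real.exp_pos _).le]
    exact hle hx le_rfl hs
  refine ⟨fun x => ∫ s, Real.exp (-(s * x)) ∂m, fun x => integral_nonneg fun s =>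
    (Real.exp_pos _).le, ?_, ?_, ?_, ?_⟩
  · intro x hx y hy hxy
    refine integral_mono_ae (hint y hy) (hint x hx) ?_
    filter_upwards [hpos] with s hs
    exact Real.exp_le_exp.2 (neg_le_neg (mul_le_mul_of_nonneg_left hxy hs.le))
  · intro x hx
    have hx' : 0 < x / 2 := half_pos hx
    refine ContinuousAt.continuousWithinAt ?_
    refine continuousAt_of_dominated (bound := fun s => (x / 2)⁻¹ * ((x / 2)⁻¹ + s)⁻¹)
      (Eventually.of_forall fun y => by fun_prop) ?_
      ((hm _ (by positivity)).1.const_mul _) (ae_of_all _ fun s => by fun_prop)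
    filter_upwards [Ioi_mem_nhds (half_lt_self hx)] with y hy
    filter_upwards [hpos] with s hs
    rw [Real.norm_of_nonneg (Real.exp_pos _).le]
    exact hle hx' (le_of_lt hy) hs
  · have := tendsto_integral_filter_of_dominated_convergence (μ := m) (l := atTop)
      (F := fun (x : ℝ) s => Real.exp (-(s * x))) (f := fun _ => 0)
      (fun s => (1 : ℝ)⁻¹ * ((1 : ℝ)⁻¹ + s)⁻¹) (Eventually.of_forall fun x => by fun_prop) ?_
      ((hm _ (by positivity)).1.const_mul _) ?_
    · simpa using this
    · filter_upwards [eventually_ge_atTop 1] with x hx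
      filter_upwards [hpos] with s hs
      rw [Real.norm_of_nonneg (Real.exp_pos _).le]
      exact hle one_pos hx hs
    · filter_upwards [hpos] with s hs
      exact Real.tendsto_exp_neg_atTop_nhds_zero.comp (tendsto_id.const_mul_atTop hs)
  · intro θ hθ
    have hexp : ∀ s x, Real.exp (-θ * x) * Real.exp (-(s * x)) = Real.exp (-(θ + s) * x) :=
      fun s x => by rw [← Real.exp_add]; ring_nf
    have hprod : Integrable (Function.uncurry fun x s =>
        Real.exp (-θ * x) * Real.exp (-(s * x))) ((volume.restrict (Ioi (0 : ℝ))).prod m) := by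
      rw [integrable_prod_iff' (Measurable.aestronglyMeasurable (by fun_prop))]
      refine ⟨?_, ?_⟩
      · filter_upwards [hpos] with s hs
        simp only [Function.uncurry, hexp]
        exact integrableOn_exp_neg_mul_Ioi (by linarith)
      · refine (hm θ hθ).1.congr ?_
        filter_upwards [hpos] with s hs
        simp only [Function.uncurry, hexp, Real.norm_eq_abs, Real.abs_exp]
        rw [integral_exp_neg_mul_Ioi (by linarith), one_div]
    have h1 : ∀ x, Real.exp (-θ * x) * ∫ s, Real.exp (-(s * x)) ∂m =
        ∫ s, Real.exp (-θ * x) * Real.exp (-(s * x)) ∂m := fun x => (integral_const_mul _ _).symm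
    simp only [h1]
    refine ⟨hprod.integral_prod_left, ?_⟩
    rw [integral_integral_swap hprod, ← (hm θ hθ).2]
    refine integral_congr_ae ?_
    filter_upwards [hpos] with s hs
    simp only [hexp]
    rw [integral_exp_neg_mul_Ioi (by linarith), one_div]

/-! ### Poisson point processes -/

theorem integral_finset_prod_infinitePi {ι : Type*} {Ω : ι → Type*}
    [∀ i, MeasurableSpace (Ω i)] (P : ∀ i, Measure (Ω i)) [∀ i, IsProbabilityMeasure (P i)]
    (s : Finset ι) {f : ∀ i, Ω i → ℂ} (hf : ∀ i, Measurable (f i)) :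
    ∫ ω, ∏ i ∈ s, f i (ω i) ∂(Measure.infinitePi P) = ∏ i ∈ s, ∫ x, f i x ∂(P i) := by
  have hind := (iIndepFun_infinitePi (P := P) (X := f) hf).precomp
    (g := ((↑) : s → ι)) Subtype.val_injective
  have := hind.integral_fun_prod_eq_prod_integral fun i =>
    ((hf i).comp (measurable_pi_apply (i : ι))).aestronglyMeasurable
  rw [Finset.prod_coe_sort s (fun i => ∫ ω, f i (ω i) ∂(Measure.infinitePi P))] at this
  refine Eq.trans ?_ (this.trans ?_)
  · refine integral_congr_ae (ae_of_all _ fun ω => ?_)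
    exact (Finset.prod_coe_sort s (fun i => f i (ω i))).symm
  · refine Finset.prod_congr rfl fun i _ => ?_
    have h := measurePreserving_eval_infinitePi P i
    rw [← h.map_eq, integral_map h.measurable.aemeasurable (hf i).aestronglyMeasurable]

section PoissonPoints

variable {ι E : Type*} [MeasurableSpace E]

/-- The law of a family of independent finite Poisson point processes, the `c`-th one consisting of
a Poisson number (with mean one) of independent points with distribution `κ c`. A configuration
records for each `c` the number of points and a sequence that starts with the points. -/
noncomputable def poissonPointLaw (κ : ι → Measure E) : Measure (ι → ℕ × (ℕ → E)) :=
  Measure.infinitePi fun c => (poissonMeasure 1).prod (Measure.infinitePi fun _ : ℕ => κ c)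

/-- The sum of `f` over the points of one cell. -/
def cellSum {M : Type*} [AddCommMonoid M] (f : E → M) (p : ℕ × (ℕ → E)) : M :=
  ∑ k ∈ Finset.range p.1, f (p.2 k)

/-- The sum of `f` over all points of a configuration. -/
noncomputable def pointSum {M : Type*} [AddCommMonoid M] [TopologicalSpace M] (f : E → M)
    (ω : ι → ℕ × (ℕ → E)) : M :=
  ∑' c, cellSum f (ω c)

instance (κ : ι → Measure E) [∀ c, IsProbabilityMeasure (κ c)] :
    IsProbabilityMeasure (poissonPointLaw κ) := by
  unfold poissonPointLaw; infer_instance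

theorem measurable_cellSum {M : Type*} [AddCommMonoid M] [MeasurableSpace M] [MeasurableAdd₂ M]
    {f : E → M} (hf : Measurable f) : Measurable (cellSum f) := by
  refine measurable_from_prod_countable_right fun n => ?_
  exact Finset.measurable_fun_sum (Finset.range n) (f := fun k (y : ℕ → E) => f (y k))
    fun k _ => hf.comp (measurable_pi_apply k)

theorem measurable_cellSum_eval {M : Type*} [AddCommMonoid M] [MeasurableSpace M]
    [MeasurableAdd₂ M] {f : E → M} (hf : Measurable f) (c : ι) :
    Measurable fun ω : ι → ℕ × (ℕ → E) => cellSum f (ω c) :=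
  (measurable_cellSum hf).comp (measurable_pi_apply c)

theorem measurable_pointSum [Countable ι] {f : E → ℝ} (hf : Measurable f) :
    Measurable (pointSum f : (ι → ℕ × (ℕ → E)) → ℝ) :=
  Measurable.tsum fun c => measurable_cellSum_eval hf c

/-- Given n points the expectation is zⁿ with z = ∫ e^w dκ, and the Poisson weights sum to e^{z-1}.
The sign of Re w keeps the integrand bounded. -/
theorem integral_exp_cellSum (κ : Measure E) [IsProbabilityMeasure κ] {w : E → ℂ}
    (hw : Measurable w) (hre : ∀ x, (w x).re ≤ 0) :
    ∫ p, Complex.exp (cellSum w p)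
      ∂((poissonMeasure 1).prod (Measure.infinitePi fun _ : ℕ => κ)) =
      Complex.exp (∫ x, (Complex.exp (w x) - 1) ∂κ) := by
  have hbd : ∀ x, ‖Complex.exp (w x)‖ ≤ 1 := fun x => by
    rw [Complex.norm_exp]; exact Real.exp_le_one_iff.2 (hre x)
  have hint : Integrable (fun x => Complex.exp (w x)) κ :=
    Integrable.of_bound (C := 1) (by fun_prop) (ae_of_all _ hbd)
  have hexp : ∀ p : ℕ × (ℕ → E), Complex.exp (cellSum w p) =
      ∏ k ∈ Finset.range p.1, Complex.exp (w (p.2 k)) := fun p => by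
    rw [cellSum, Complex.exp_sum]
  rw [integral_prod]
  · have hn : ∀ n : ℕ, ∫ y : ℕ → E, Complex.exp (cellSum w (n, y))
        ∂(Measure.infinitePi fun _ : ℕ => κ) = (∫ x, Complex.exp (w x) ∂κ) ^ n := by
      intro n
      simp only [hexp]
      rw [integral_finset_prod_infinitePi (fun _ : ℕ => κ) (Finset.range n)
        (f := fun _ x => Complex.exp (w x)) (fun _ => by fun_prop)]
      simp
    simp only [hn]
    rw [integral_poissonMeasure, integral_sub hint (integrable_const 1)]
    simp only [integral_const, probReal_univ, one_smul]
    rw [Complex.exp_sub, show Complex.exp (∫ x, Complex.exp (w x) ∂κ) =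
        ∑' n : ℕ, (∫ x, Complex.exp (w x) ∂κ) ^ n / (n.factorial : ℂ) by
      rw [Complex.exp_eq_exp_ℂ, NormedSpace.exp_eq_tsum_div], ← tsum_div_const]
    refine tsum_congr fun n => ?_
    rw [Complex.real_smul]
    simp only [NNReal.coe_one, one_pow, mul_one]
    push_cast
    rw [Complex.exp_neg]
    field_simp
  · refine Integrable.of_bound (C := 1)
      (Complex.measurable_exp.comp (measurable_cellSum hw)).aestronglyMeasurable
      (ae_of_all _ fun p => ?_)
    rw [hexp, norm_prod]
    exact Finset.prod_le_one (fun _ _ => norm_nonneg _) fun k _ => hbd _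

theorem lintegral_cellSum (κ : Measure E) [IsProbabilityMeasure κ] {f : E → ℝ≥0∞}
    (hf : Measurable f) :
    ∫⁻ p, cellSum f p ∂((poissonMeasure 1).prod (Measure.infinitePi fun _ : ℕ => κ)) =
      (∫⁻ n : ℕ, (n : ℝ≥0∞) ∂(poissonMeasure 1)) * ∫⁻ x, f x ∂κ := by
  rw [lintegral_prod _ (measurable_cellSum hf).aemeasurable,
    ← lintegral_mul_const _ (by fun_prop)]
  refine lintegral_congr fun n => ?_
  simp only [cellSum]
  rw [lintegral_finsetSum _ fun k _ =>
    show Measurable fun y : ℕ → E => f (y k) from hf.comp (measurable_pi_apply k)]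
  have : ∀ k : ℕ, ∫⁻ y : ℕ → E, f (y k) ∂(Measure.infinitePi fun _ : ℕ => κ) = ∫⁻ x, f x ∂κ :=
    fun k => (measurePreserving_eval_infinitePi (fun _ : ℕ => κ) k).lintegral_comp hf
  simp [this]

theorem lintegral_natCast_poissonMeasure_one_lt_top :
    ∫⁻ n : ℕ, (n : ℝ≥0∞) ∂(poissonMeasure 1) < ∞ := by
  have hint : Integrable (fun n : ℕ => (n : ℝ)) (poissonMeasure 1) := by
    rw [integrable_poissonMeasure_iff]
    have h1 : Summable fun n : ℕ => Real.exp (-1) * (1 / (n.factorial : ℝ)) := by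
      have := (Real.summable_pow_div_factorial 1).mul_left (Real.exp (-1))
      simpa using this
    rw [← summable_nat_add_iff 1]
    refine h1.congr fun n => ?_
    rw [Nat.factorial_succ]
    simp only [NNReal.coe_one, one_pow, mul_one, Real.norm_natCast]
    push_cast
    field_simp
  have := hint.2
  rw [hasFiniteIntegral_iff_ofReal (ae_of_all _ fun n => Nat.cast_nonneg n)] at this
  simpa using this

theorem norm_cellSum_le {F : Type*} {w : F → ℂ} {h : F → ℝ} (hw : ∀ x, ‖w x‖ ≤ h x) (p : ℕ × (ℕ → F)) :
    ‖cellSum w p‖ ≤ cellSum h p :=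
  (norm_sum_le _ _).trans (Finset.sum_le_sum fun _ _ => hw _)

theorem norm_exp_sub_one_le_of_re_nonpos {z : ℂ} (hz : z.re ≤ 0) {r : ℝ} (hr : ‖z‖ ≤ r) :
    ‖Complex.exp z - 1‖ ≤ 2 * min 1 r := by
  rcases le_total ‖z‖ 1 with h | h
  · have h1 := Complex.norm_exp_sub_one_le h
    refine h1.trans ?_
    gcongr
    exact le_min h hr
  · rw [min_eq_left (h.trans hr)]
    refine (norm_sub_le _ _).trans ?_
    rw [Complex.norm_exp, norm_one]
    linarith [Real.exp_le_one_iff.2 hz]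

variable [Countable ι] {κ : ι → Measure E} [∀ c, IsProbabilityMeasure (κ c)]

/-- Almost surely, a nonnegative function `h` with `∫ (1 ∧ h) < ∞` is summable over the points. -/
theorem ae_summable_cellSum {h : E → ℝ} (hm : Measurable h) (h0 : ∀ x, 0 ≤ h x)
    (hint : Integrable (fun x => min 1 (h x)) (Measure.sum κ)) :
    ∀ᵐ ω ∂(poissonPointLaw κ), Summable fun c => cellSum h (ω c) := by
  set f : E → ℝ≥0∞ := fun x => ENNReal.ofReal (min 1 (h x)) with hf
  have hfm : Measurable f := by fun_prop
  have hfin : ∫⁻ ω, ∑' c, cellSum f (ω c) ∂(poissonPointLaw κ) ≠ ∞ := by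
    rw [lintegral_tsum fun c => (measurable_cellSum_eval hfm c).aemeasurable]
    have h1 : ∀ c, ∫⁻ ω, cellSum f (ω c) ∂(poissonPointLaw κ) =
        (∫⁻ n : ℕ, (n : ℝ≥0∞) ∂(poissonMeasure 1)) * ∫⁻ x, f x ∂(κ c) := fun c => by
      rw [← lintegral_cellSum (κ c) hfm]
      exact (measurePreserving_eval_infinitePi (fun c => (poissonMeasure 1).prod
        (Measure.infinitePi fun _ : ℕ => κ c)) c).lintegral_comp (measurable_cellSum hfm)
    simp only [h1]
    rw [ENNReal.tsum_mul_left, ← lintegral_sum_measure]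
    refine ENNReal.mul_ne_top lintegral_natCast_poissonMeasure_one_lt_top.ne ?_
    have := hint.2
    rw [hasFiniteIntegral_iff_ofReal (ae_of_all _ fun x => le_min zero_le_one (h0 x))] at this
    exact this.ne
  have hae := ae_lt_top' (Measurable.aemeasurable (Measurable.tsum fun c =>
    measurable_cellSum_eval hfm c)) hfin
  filter_upwards [hae] with ω hω
  -- The truncated function min(1, h) has a finite expected sum over the points. Terms of a
  -- convergent sum are eventually below 1, and in such cells the truncation is inactive.
  have hlt : ∀ᶠ c in cofinite, cellSum f (ω c) < 1 :=
    (ENNReal.tendsto_cofinite_zero_of_tsum_ne_top hω.ne).eventually_lt_const one_pos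
  refine (summable_congr_cofinite ?_).1 (ENNReal.summable_toReal hω.ne)
  filter_upwards [hlt] with c hc
  simp only [cellSum]
  rw [ENNReal.toReal_sum fun k _ => ENNReal.ofReal_ne_top]
  refine Finset.sum_congr rfl fun k hk => ?_
  have h2 : f ((ω c).2 k) < 1 :=
    (Finset.single_le_sum (f := fun k => f ((ω c).2 k)) (fun _ _ => zero_le) hk).trans_lt hc
  simp only [hf] at h2 ⊢
  rw [ENNReal.ofReal_lt_one, min_lt_iff] at h2
  have h3 : h ((ω c).2 k) < 1 := h2.resolve_left (lt_irrefl _)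
  rw [min_eq_right h3.le, ENNReal.toReal_ofReal (h0 _)]

theorem integrable_exp_sub_one {μ : Measure E} {w : E → ℂ} (hw : Measurable w)
    (hre : ∀ x, (w x).re ≤ 0) {h : E → ℝ} (hwh : ∀ x, ‖w x‖ ≤ h x)
    (hint : Integrable (fun x => min 1 (h x)) μ) :
    Integrable (fun x => Complex.exp (w x) - 1) μ :=
  (hint.const_mul 2).mono' (Measurable.aestronglyMeasurable (by fun_prop))
    (ae_of_all _ fun x => norm_exp_sub_one_le_of_re_nonpos (hre x) (hwh x))

/-- The exponential formula for Poisson point processes. -/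
theorem integral_exp_pointSum {w : E → ℂ} (hw : Measurable w) (hre : ∀ x, (w x).re ≤ 0)
    {h : E → ℝ} (hm : Measurable h) (hwh : ∀ x, ‖w x‖ ≤ h x)
    (hint : Integrable (fun x => min 1 (h x)) (Measure.sum κ)) :
    ∫ ω, Complex.exp (pointSum w ω) ∂(poissonPointLaw κ) =
      Complex.exp (∫ x, (Complex.exp (w x) - 1) ∂(Measure.sum κ)) := by
  have h0 : ∀ x, 0 ≤ h x := fun x => (norm_nonneg _).trans (hwh x)
  have hsum := hasSum_integral_measure (integrable_exp_sub_one hw hre hwh hint)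
  have hlim1 : Tendsto (fun s : Finset ι => Complex.exp
      (∑ c ∈ s, ∫ x, (Complex.exp (w x) - 1) ∂(κ c))) atTop
      (𝓝 (Complex.exp (∫ x, (Complex.exp (w x) - 1) ∂(Measure.sum κ)))) :=
    (Complex.continuous_exp.tendsto _).comp hsum
  have hcell : ∀ c, Measurable fun ω : ι → ℕ × (ℕ → E) => cellSum w (ω c) :=
    fun c => measurable_cellSum_eval hw c
  have hfin : ∀ s : Finset ι, ∫ ω, Complex.exp (∑ c ∈ s, cellSum w (ω c)) ∂(poissonPointLaw κ) =
      Complex.exp (∑ c ∈ s, ∫ x, (Complex.exp (w x) - 1) ∂(κ c)) := by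
    intro s
    simp only [Complex.exp_sum]
    unfold poissonPointLaw
    rw [integral_finset_prod_infinitePi _ s (f := fun _ p => Complex.exp (cellSum w p))
      (fun c => Complex.measurable_exp.comp (measurable_cellSum hw))]
    exact Finset.prod_congr rfl fun c _ => integral_exp_cellSum (κ c) hw hre
  -- Independence settles finitely many cells; the integrands have modulus at most 1, so dominated
  -- convergence reaches all of them.
  have hlim2 : Tendsto (fun s : Finset ι =>
      ∫ ω, Complex.exp (∑ c ∈ s, cellSum w (ω c)) ∂(poissonPointLaw κ)) atTop
      (𝓝 (∫ ω, Complex.exp (pointSum w ω) ∂(poissonPointLaw κ))) := by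
    refine tendsto_integral_filter_of_dominated_convergence (fun _ => 1)
      (Eventually.of_forall fun s => ?_) (Eventually.of_forall fun s => ae_of_all _ fun ω => ?_)
      (integrable_const _) ?_
    · exact (Complex.measurable_exp.comp
        (Finset.measurable_fun_sum s fun c _ => hcell c)).aestronglyMeasurable
    · rw [Complex.norm_exp, Real.exp_le_one_iff, Complex.re_sum]
      refine Finset.sum_nonpos fun c _ => ?_
      rw [cellSum, Complex.re_sum]
      exact Finset.sum_nonpos fun k _ => hre _
    · filter_upwards [ae_summable_cellSum hm h0 hint] with ω hω
      have hs : Summable fun c => cellSum w (ω c) :=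
        Summable.of_norm_bounded hω fun c => norm_cellSum_le hwh _
      exact (Complex.continuous_exp.tendsto _).comp hs.hasSum
  simp only [hfin] at hlim2
  exact tendsto_nhds_unique hlim2 hlim1

end PoissonPoints

/-! ### Subordinators from a planar Poisson process -/

/-- Lebesgue measure on the unit square with upper right corner `c + (1, 1)`. -/
noncomputable def unitCell (c : ℤ × ℤ) : Measure (ℝ × ℝ) :=
  (volume.restrict (Ioc (c.1 : ℝ) (c.1 + 1))).prod (volume.restrict (Ioc (c.2 : ℝ) (c.2 + 1)))

instance (c : ℤ × ℤ) : IsProbabilityMeasure (unitCell c) := by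
  have h : ∀ a : ℤ, IsProbabilityMeasure (volume.restrict (Ioc (a : ℝ) (a + 1))) := fun a =>
    ⟨by simp⟩
  have := h c.1
  have := h c.2
  unfold unitCell
  infer_instance

theorem sum_unitCell : Measure.sum unitCell = (volume : Measure ℝ).prod volume := by
  have h : Measure.sum (fun a : ℤ => volume.restrict (Ioc (a : ℝ) (a + 1))) = volume := by
    rw [← Measure.restrict_iUnion (pairwise_disjoint_Ioc_intCast ℝ) fun _ => measurableSet_Ioc,
      iUnion_Ioc_intCast, Measure.restrict_univ]
  have h2 := Measure.prod_sum (fun a : ℤ => volume.restrict (Ioc (a : ℝ) (a + 1)))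
    (fun a : ℤ => volume.restrict (Ioc (a : ℝ) (a + 1)))
  rw [h] at h2
  exact h2.symm

/-- The jump of size `g y`, counted if the time `s` belongs to `A`. -/
noncomputable def jump (g : ℝ → ℝ) (A : Set ℝ) (p : ℝ × ℝ) : ℝ :=
  A.indicator (fun _ => 1) p.1 * g p.2

section Subordinator

variable {g : ℝ → ℝ}

theorem measurable_jump (hg : Measurable g) {A : Set ℝ} (hA : MeasurableSet A) :
    Measurable (jump g A) := by
  have : Measurable (A.indicator fun _ => (1 : ℝ)) := measurable_const.indicator hA
  unfold jump
  fun_prop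

theorem jump_nonneg (h0 : ∀ y, 0 ≤ g y) (A : Set ℝ) (p : ℝ × ℝ) : 0 ≤ jump g A p :=
  mul_nonneg (indicator_nonneg (fun _ _ => zero_le_one) _) (h0 _)

theorem jump_mono (h0 : ∀ y, 0 ≤ g y) {A B : Set ℝ} (hAB : A ⊆ B) (p : ℝ × ℝ) :
    jump g A p ≤ jump g B p :=
  mul_le_mul_of_nonneg_right
    (indicator_le_indicator_of_subset hAB (fun _ => zero_le_one) _) (h0 _)

theorem cellSum_jump_mono (h0 : ∀ y, 0 ≤ g y) {A B : Set ℝ} (hAB : A ⊆ B)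
    (p : ℕ × (ℕ → ℝ × ℝ)) : cellSum (jump g A) p ≤ cellSum (jump g B) p :=
  Finset.sum_le_sum fun _ _ => jump_mono h0 hAB _

theorem cellSum_jump_nonneg (h0 : ∀ y, 0 ≤ g y) (A : Set ℝ)
    (p : ℕ × (ℕ → ℝ × ℝ)) : 0 ≤ cellSum (jump g A) p :=
  Finset.sum_nonneg fun _ _ => jump_nonneg h0 _ _

theorem summable_cellSum_jump (h0 : ∀ y, 0 ≤ g y) {A B : Set ℝ} (hAB : A ⊆ B)
    {ω : ℤ × ℤ → ℕ × (ℕ → ℝ × ℝ)} (h : Summable fun c => cellSum (jump g B) (ω c)) :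
    Summable fun c => cellSum (jump g A) (ω c) :=
  h.of_nonneg_of_le (fun _ => cellSum_jump_nonneg h0 _ _) fun _ => cellSum_jump_mono h0 hAB _

theorem integrable_min_one_const_mul_jump (h0 : ∀ y, 0 ≤ g y)
    (hint : Integrable (fun y => min 1 (g y))) {A : Set ℝ} (hA : MeasurableSet A)
    (hAfin : volume A ≠ ∞) (hg : Measurable g) {C : ℝ} (hC : 0 ≤ C) :
    Integrable (fun p => min 1 (C * jump g A p)) (Measure.sum unitCell) := by
  rw [sum_unitCell]
  have h1 : Integrable (A.indicator fun _ => (1 : ℝ)) :=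
    (integrable_indicator_iff hA).2 (integrableOn_const hAfin)
  refine ((h1.mul_prod hint).const_mul (1 + C)).mono'
    (Measurable.aestronglyMeasurable
      (measurable_const.min ((measurable_jump hg hA).const_mul C))) (ae_of_all _ fun p => ?_)
  rw [Real.norm_of_nonneg (le_min zero_le_one (mul_nonneg hC (jump_nonneg h0 _ _)))]
  simp only [jump]
  by_cases hp : p.1 ∈ A
  · simp only [indicator_of_mem hp, one_mul]
    have := h0 p.2
    rcases min_cases 1 (g p.2) with ⟨h1, h2⟩ | ⟨h1, h2⟩ <;> rw [h1]
    · exact (min_le_left _ _).trans (by linarith)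
    · exact (min_le_right _ _).trans (by nlinarith)
  · simp [indicator_of_notMem hp]

theorem ae_summable_cellSum_jump (hg : Measurable g) (h0 : ∀ y, 0 ≤ g y)
    (hint : Integrable (fun y => min 1 (g y))) :
    ∀ᵐ ω ∂(poissonPointLaw unitCell), ∀ n : ℕ,
      Summable fun c => cellSum (jump g (Ioc 0 (n : ℝ))) (ω c) := by
  rw [ae_all_iff]; intro n
  refine ae_summable_cellSum (measurable_jump hg measurableSet_Ioc) (jump_nonneg h0 _) ?_
  simpa using integrable_min_one_const_mul_jump h0 hint (A := Ioc 0 (n : ℝ)) measurableSet_Ioc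
    (by simp) hg zero_le_one

/-- The joint Laplace transform of the sums of the jumps in disjoint sets of times. -/
theorem integral_exp_sum_pointSum_jump (hg : Measurable g) (h0 : ∀ y, 0 ≤ g y)
    (hint : Integrable (fun y => min 1 (g y))) {n : ℕ} {A : Fin n → Set ℝ}
    (hA : ∀ i, MeasurableSet (A i)) (hdisj : Pairwise fun i j => Disjoint (A i) (A j)) {T : ℕ}
    (hT : ∀ i, A i ⊆ Ioc 0 (T : ℝ)) {z : Fin n → ℂ} (hz : ∀ i, (z i).re ≤ 0) :
    ∫ ω, Complex.exp (∑ i, z i * (pointSum (jump g (A i)) ω : ℝ)) ∂(poissonPointLaw unitCell) =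
      Complex.exp (∑ i, volume.real (A i) * ∫ y, (Complex.exp (z i * g y) - 1)) := by
  set w : ℝ × ℝ → ℂ := fun p => ∑ i, z i * (jump g (A i) p : ℝ) with hw
  set C : ℝ := ∑ i, ‖z i‖ with hC
  have hC0 : 0 ≤ C := Finset.sum_nonneg fun i _ => norm_nonneg _
  have hwm : Measurable w := Finset.measurable_fun_sum _ fun i _ =>
    (Complex.measurable_ofReal.comp (measurable_jump hg (hA i))).const_mul _
  have hre : ∀ p, (w p).re ≤ 0 := fun p => by
    rw [hw]; simp only [Complex.re_sum, Complex.re_mul_ofReal]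
    exact Finset.sum_nonpos fun i _ => mul_nonpos_of_nonpos_of_nonneg (hz i) (jump_nonneg h0 _ _)
  have hwh : ∀ p, ‖w p‖ ≤ C * jump g (Ioc 0 (T : ℝ)) p := fun p => by
    rw [hC, Finset.sum_mul]
    refine (norm_sum_le _ _).trans (Finset.sum_le_sum fun i _ => ?_)
    rw [norm_mul, Complex.norm_of_nonneg (jump_nonneg h0 _ _)]
    exact mul_le_mul_of_nonneg_left (jump_mono h0 (hT i) p) (norm_nonneg _)
  have hI := integrable_min_one_const_mul_jump h0 hint (A := Ioc 0 (T : ℝ)) measurableSet_Ioc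
    (by simp) hg hC0
  have key := integral_exp_pointSum hwm hre
    ((measurable_jump hg measurableSet_Ioc).const_mul C) hwh hI
  have hsum : ∀ᵐ ω ∂(poissonPointLaw unitCell),
      pointSum w ω = ∑ i, z i * (pointSum (jump g (A i)) ω : ℝ) := by
    filter_upwards [ae_summable_cellSum_jump hg h0 hint] with ω hω
    have hs : ∀ i, HasSum (fun c => cellSum (jump g (A i)) (ω c)) (pointSum (jump g (A i)) ω) :=
      fun i => (summable_cellSum_jump h0 (hT i) (hω T)).hasSum
    have h1 : HasSum (fun c => ∑ i, z i * (cellSum (jump g (A i)) (ω c) : ℝ))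
        (∑ i, z i * (pointSum (jump g (A i)) ω : ℝ)) :=
      hasSum_sum fun i _ => (Complex.hasSum_ofReal.2 (hs i)).mul_left (z i)
    rw [← h1.tsum_eq, pointSum]
    refine tsum_congr fun c => ?_
    simp only [cellSum, hw]
    rw [Finset.sum_comm]
    refine Finset.sum_congr rfl fun i _ => ?_
    rw [← Finset.mul_sum, Complex.ofReal_sum]
  rw [integral_congr_ae (g := fun ω => Complex.exp (pointSum w ω))
    (by filter_upwards [hsum] with ω hω; rw [hω]), key]
  congr 1
  -- A given time lies in at most one of the disjoint sets, so e^w - 1 splits into a sum. This is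
  -- the source of independent increments.
  have hpt : ∀ p : ℝ × ℝ, Complex.exp (w p) - 1 =
      ∑ i, ((A i).indicator (fun _ => (1 : ℂ)) p.1) * (Complex.exp (z i * g p.2) - 1) := by
    intro p
    by_cases hp : ∃ i, p.1 ∈ A i
    · obtain ⟨i, hi⟩ := hp
      have hne : ∀ j, j ≠ i → p.1 ∉ A j := fun j hj hpj =>
        Set.disjoint_left.1 (hdisj hj) hpj hi
      rw [hw]; simp only [jump]
      rw [Finset.sum_eq_single i, Finset.sum_eq_single i]
      · simp [hi]
      · intro j _ hj; simp [hne j hj]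
      · simp
      · intro j _ hj; simp [hne j hj]
      · simp
    · push Not at hp
      simp [hw, jump, hp]
  have hgi : ∀ i, Integrable (fun y => Complex.exp (z i * g y) - 1) := fun i => by
    refine integrable_exp_sub_one (h := fun y => ‖z i‖ * g y) (by fun_prop) (fun y => ?_)
      (fun y => ?_) ?_
    · rw [Complex.re_mul_ofReal]; exact mul_nonpos_of_nonpos_of_nonneg (hz i) (h0 y)
    · rw [norm_mul, Complex.norm_of_nonneg (h0 y)]
    · refine (hint.const_mul (1 + ‖z i‖)).mono' (Measurable.aestronglyMeasurable (by fun_prop))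
        (ae_of_all _ fun y => ?_)
      have := h0 y
      have hzn := norm_nonneg (z i)
      rw [Real.norm_of_nonneg (by positivity)]
      rcases min_cases 1 (g y) with ⟨h1, h2⟩ | ⟨h1, h2⟩ <;> rw [h1]
      · exact (min_le_left _ _).trans (by linarith)
      · exact (min_le_right _ _).trans (by nlinarith)
  have hai : ∀ i, Integrable ((A i).indicator fun _ => (1 : ℂ)) := fun i =>
    (integrable_indicator_iff (hA i)).2 (integrableOn_const
      (ne_top_of_le_ne_top (by simp) (measure_mono (hT i) : volume (A i) ≤ _)))
  simp only [hpt]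
  rw [sum_unitCell, integral_finsetSum _ fun i _ => (hai i).mul_prod (hgi i)]
  refine Finset.sum_congr rfl fun i _ => ?_
  have hmul := integral_prod_mul (μ := (volume : Measure ℝ)) (ν := (volume : Measure ℝ))
    ((A i).indicator fun _ => (1 : ℂ)) (fun y => Complex.exp (z i * g y) - 1)
  rw [integral_indicator_const _ (hA i)] at hmul
  rw [hmul]
  simp

end Subordinator

/-- As r ↓ t the indicator at a fixed s is eventually constant; the closed right end of the interval
is what makes the paths right-continuous. -/
theorem continuousWithinAt_indicator_Ioc_zero (s : ℝ) (t : ℝ≥0) :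
    ContinuousWithinAt (fun r : ℝ≥0 => (Ioc 0 (r : ℝ)).indicator (fun _ => (1 : ℝ)) s)
      (Ici t) t := by
  refine ContinuousWithinAt.congr_of_eventuallyEq
    (f := fun _ => (Ioc 0 (t : ℝ)).indicator (fun _ => (1 : ℝ)) s)
    continuousWithinAt_const ?_ rfl
  by_cases hs : s ≤ t
  · filter_upwards [self_mem_nhdsWithin] with r hr
    have : s ≤ r := hs.trans hr
    simp [indicator, hs, this]
  · push Not at hs
    have hnh : ∀ᶠ r : ℝ≥0 in 𝓝 t, (r : ℝ) < s :=
      NNReal.continuous_coe.continuousAt.eventually_lt_const hs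
    filter_upwards [mem_nhdsWithin_of_mem_nhds hnh] with r hr
    simp [indicator, not_le.2 hs, not_le.2 hr]

/-- Existence of driftless subordinators whose Lévy measure is the image under `g` of Lebesgue
measure. -/
theorem exists_subordinator {g : ℝ → ℝ} (hg : Measurable g) (h0 : ∀ y, 0 ≤ g y)
    (hint : Integrable (fun y => min 1 (g y))) :
    ∃ (Ω : Type) (_ : MeasurableSpace Ω) (P : Measure Ω) (S : ℝ≥0 → Ω → ℝ),
      IsProbabilityMeasure P ∧ (∀ t, Measurable (S t)) ∧ (∀ ω, S 0 ω = 0) ∧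
      (∀ ω, Monotone fun t => S t ω) ∧
      (∀ ω t, ContinuousWithinAt (fun t => S t ω) (Ici t) t) ∧ HasIndepIncrements S P ∧
      (∀ s t : ℝ≥0, s ≤ t → P.map (fun ω => S t ω - S s ω) = P.map (S (t - s))) ∧
      ∀ (t : ℝ≥0) (z : ℂ), z.re ≤ 0 → ∫ ω, Complex.exp (z * S t ω) ∂P =
        Complex.exp (t * ∫ y, (Complex.exp (z * g y) - 1)) := by
  have hae := ae_summable_cellSum_jump hg h0 hint
  -- The process is set to 0 on a measurable null set outside of which all sums converge, so that
  -- path properties hold for every ω.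
  obtain ⟨N, hN, hNm, hN0⟩ := exists_measurable_superset_of_null hae
  have hgood : ∀ ω ∉ N, ∀ n : ℕ, Summable fun c => cellSum (jump g (Ioc 0 (n : ℝ))) (ω c) := by
    intro ω hω
    by_contra hcon
    exact hω (hN hcon)
  have haeN : ∀ᵐ ω ∂(poissonPointLaw unitCell), ω ∉ N := measure_eq_zero_iff_ae_notMem.1 hN0
  have hsummable : ∀ ω ∉ N, ∀ {A : Set ℝ} {t : ℝ≥0}, A ⊆ Ioc 0 (t : ℝ) →
      Summable fun c => cellSum (jump g A) (ω c) := by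
    intro ω hω A t hA
    obtain ⟨n, hn⟩ := exists_nat_ge (t : ℝ)
    exact summable_cellSum_jump h0 (hA.trans (Ioc_subset_Ioc_right hn)) (hgood ω hω n)
  let S : ℝ≥0 → (ℤ × ℤ → ℕ × (ℕ → ℝ × ℝ)) → ℝ := fun t =>
    Nᶜ.indicator (pointSum (jump g (Ioc 0 (t : ℝ))))
  have hSgood : ∀ ω ∉ N, ∀ t, S t ω = pointSum (jump g (Ioc 0 (t : ℝ))) ω := fun ω hω t =>
    indicator_of_mem (show ω ∈ Nᶜ from hω) _
  have hSbad : ∀ ω ∈ N, ∀ t, S t ω = 0 := fun ω hω t =>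
    indicator_of_notMem (not_not.2 hω) _
  have hSm : ∀ t, Measurable (S t) := fun t =>
    (measurable_pointSum (measurable_jump hg measurableSet_Ioc)).indicator hNm.compl
  have hinc : ∀ s t : ℝ≥0, s ≤ t → ∀ᵐ ω ∂(poissonPointLaw unitCell),
      S t ω - S s ω = pointSum (jump g (Ioc (s : ℝ) t)) ω := by
    intro s t hst
    filter_upwards [haeN] with ω hω
    rw [hSgood ω hω, hSgood ω hω, sub_eq_iff_eq_add]
    unfold pointSum
    have hst' : (s : ℝ) ≤ t := hst
    rw [← Summable.tsum_add (hsummable ω hω (t := t) (Ioc_subset_Ioc_left s.coe_nonneg))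
      (hsummable ω hω (t := s) subset_rfl)]
    refine tsum_congr fun c => ?_
    unfold cellSum
    rw [← Finset.sum_add_distrib]
    refine Finset.sum_congr rfl fun k _ => ?_
    unfold jump
    rw [← add_mul, ← Ioc_union_Ioc_eq_Ioc s.coe_nonneg hst', indicator_union_of_disjoint
      (Set.Ioc_disjoint_Ioc_of_le le_rfl)]
    ring
  have hlaw : ∀ (s t : ℝ≥0), s ≤ t → ∀ z : ℂ, z.re ≤ 0 →
      ∫ ω, Complex.exp (z * (S t ω - S s ω : ℝ)) ∂(poissonPointLaw unitCell) =
        Complex.exp (((t - s : ℝ≥0) : ℝ) * ∫ y, (Complex.exp (z * g y) - 1)) := by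
    intro s t hst z hz
    obtain ⟨T, hT⟩ := exists_nat_ge (t : ℝ)
    have := integral_exp_sum_pointSum_jump hg h0 hint (n := 1) (A := fun _ => Ioc (s : ℝ) t)
      (fun _ => measurableSet_Ioc) (fun i j hij => absurd (Subsingleton.elim i j) hij) (T := T)
      (fun _ => Ioc_subset_Ioc s.coe_nonneg hT) (z := fun _ => z) (fun _ => hz)
    simp only [Fin.sum_univ_one, Real.volume_real_Ioc_of_le (NNReal.coe_le_coe.2 hst)] at this
    rw [NNReal.coe_sub hst, ← this]
    refine integral_congr_ae ?_
    filter_upwards [hinc s t hst] with ω hω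
    rw [hω]
  have hzero : ∀ ω, S 0 ω = 0 := by
    intro ω
    by_cases hω : ω ∈ N
    · exact hSbad ω hω 0
    · rw [hSgood ω hω]
      simp [pointSum, cellSum, jump]
  have hlaw0 : ∀ (t : ℝ≥0) (z : ℂ), z.re ≤ 0 →
      ∫ ω, Complex.exp (z * S t ω) ∂(poissonPointLaw unitCell) =
        Complex.exp (t * ∫ y, (Complex.exp (z * g y) - 1)) := by
    intro t z hz
    simpa [hzero] using hlaw 0 t t.2 z hz
  refine ⟨_, inferInstance, poissonPointLaw unitCell, S, inferInstance, hSm, hzero, ?_, ?_, ?_, ?_,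
    hlaw0⟩
  · intro ω s t hst
    by_cases hω : ω ∈ N
    · simp [hSbad ω hω]
    · simp only [hSgood ω hω]
      exact Summable.tsum_le_tsum (fun c => cellSum_jump_mono h0
        (Ioc_subset_Ioc_right (NNReal.coe_le_coe.2 hst)) _)
        (hsummable ω hω (t := s) subset_rfl) (hsummable ω hω (t := t) subset_rfl)
  · intro ω t
    by_cases hω : ω ∈ N
    · simp only [hSbad ω hω]; exact continuousWithinAt_const
    · simp only [hSgood ω hω]
      refine tendsto_tsum_of_dominated_convergence
        (hsummable ω hω (t := t + 1) subset_rfl) (fun c => ?_) ?_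
      · unfold cellSum jump
        exact tendsto_finsetSum _ fun k _ =>
          (continuousWithinAt_indicator_Ioc_zero _ t).tendsto.mul_const _
      · have hlt : t < t + 1 := lt_add_one t
        filter_upwards [mem_nhdsWithin_of_mem_nhds (Iio_mem_nhds hlt)] with r hr c
        rw [Real.norm_of_nonneg (cellSum_jump_nonneg h0 _ _)]
        exact cellSum_jump_mono h0 (Ioc_subset_Ioc_right
          (NNReal.coe_le_coe.2 (le_of_lt hr))) _
  · intro n t ht
    have hm : ∀ i : Fin n, Measurable fun ω => S (t i.succ) ω - S (t i.castSucc) ω := fun i =>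
      (hSm _).sub (hSm _)
    have hle : ∀ i : Fin n, t i.castSucc ≤ t i.succ := fun i => ht i.castSucc_lt_succ.le
    -- Independence is checked as factorization of the joint characteristic function, supplied by
    -- the formula for disjoint time intervals.
    rw [iIndepFun_iff_charFun_pi fun i => (hm i).aemeasurable]
    intro ξ
    have hre : ∀ i, ((ξ i : ℂ) * Complex.I).re ≤ 0 := fun i => by simp
    obtain ⟨T, hT⟩ := exists_nat_ge ((t (Fin.last n) : ℝ≥0) : ℝ)
    have hdisj : Pairwise fun i j : Fin n => Disjoint
        (Ioc ((t i.castSucc : ℝ≥0) : ℝ) (t i.succ)) (Ioc ((t j.castSucc : ℝ≥0) : ℝ) (t j.succ)) := by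
      intro i j hij
      rcases lt_or_gt_of_ne hij with h | h
      · exact Set.Ioc_disjoint_Ioc_of_le
          (NNReal.coe_le_coe.2 (ht (Fin.succ_le_castSucc_iff.2 h)))
      · exact (Set.Ioc_disjoint_Ioc_of_le
          (NNReal.coe_le_coe.2 (ht (Fin.succ_le_castSucc_iff.2 h)))).symm
    have key := integral_exp_sum_pointSum_jump hg h0 hint
      (A := fun i : Fin n => Ioc ((t i.castSucc : ℝ≥0) : ℝ) (t i.succ))
      (fun i => measurableSet_Ioc) hdisj (T := T)
      (fun i => Ioc_subset_Ioc (t i.castSucc).coe_nonneg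
        ((NNReal.coe_le_coe.2 (ht (Fin.le_last _))).trans hT)) (z := fun i => ξ i * Complex.I) hre
    have hmt : Measurable fun ω => WithLp.toLp 2
        fun i : Fin n => S (t i.succ) ω - S (t i.castSucc) ω := by fun_prop
    rw [charFun_apply, integral_map hmt.aemeasurable (by fun_prop)]
    have hallinc : ∀ᵐ ω ∂(poissonPointLaw unitCell), ∀ i : Fin n,
        S (t i.succ) ω - S (t i.castSucc) ω =
          pointSum (jump g (Ioc ((t i.castSucc : ℝ≥0) : ℝ) (t i.succ))) ω :=
      ae_all_iff.2 fun i => hinc _ _ (hle i)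
    rw [integral_congr_ae (g := fun ω => Complex.exp (∑ i, ξ i * Complex.I *
      (pointSum (jump g (Ioc ((t i.castSucc : ℝ≥0) : ℝ) (t i.succ))) ω : ℝ))) ?_, key,
      Complex.exp_sum]
    · refine Finset.prod_congr rfl fun i _ => ?_
      rw [charFun_apply_real, integral_map (hm i).aemeasurable (by fun_prop)]
      have h1 := hlaw _ _ (hle i) (ξ i * Complex.I) (hre i)
      rw [Real.volume_real_Ioc_of_le (NNReal.coe_le_coe.2 (hle i)), ← NNReal.coe_sub (hle i), ← h1]
      refine integral_congr_ae (ae_of_all _ fun ω => ?_)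
      simp only
      ring_nf
    · filter_upwards [hallinc] with ω hω
      congr 1
      rw [PiLp.inner_apply]
      push_cast
      rw [Finset.sum_mul]
      refine Finset.sum_congr rfl fun i _ => ?_
      rw [← hω i]
      simp
      ring
  · intro s t hst
    have hm : Measurable fun ω => S t ω - S s ω := (hSm _).sub (hSm _)
    have := Measure.isProbabilityMeasure_map (μ := poissonPointLaw unitCell) hm.aemeasurable
    have := Measure.isProbabilityMeasure_map (μ := poissonPointLaw unitCell)
      (hSm (t - s)).aemeasurable
    refine Measure.ext_of_charFun (funext fun ξ => ?_)
    rw [charFun_apply_real, charFun_apply_real, integral_map hm.aemeasurable (by fun_prop),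
      integral_map (hSm _).aemeasurable (by fun_prop)]
    have h1 := hlaw s t hst (ξ * Complex.I) (by simp)
    have h2 := hlaw0 (t - s) (ξ * Complex.I) (by simp)
    have := h1.trans h2.symm
    simp only [mul_right_comm _ Complex.I] at this
    exact this

/-! ### Lévy processes with a prescribed jump tail -/

/-- A continuous decreasing tail function `u` on `(0, ∞)` is the tail of the image of Lebesgue
measure under its generalized inverse. -/
theorem exists_tail_inverse {u : ℝ → ℝ} (hanti : AntitoneOn u (Ioi 0))
    (hcont : ContinuousOn u (Ioi 0)) (hlim : Tendsto u atTop (𝓝 0)) :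
    ∃ G : ℝ → ℝ, Measurable G ∧ (∀ y, 0 ≤ G y) ∧ ∀ x, 0 < x → {y | x < G y} = Ioo 0 (u x) := by
  let G : ℝ → ℝ := fun y => if 0 < y then sSup {x | 0 < x ∧ y < u x} else 0
  have hbdd : ∀ y, 0 < y → BddAbove {x | 0 < x ∧ y < u x} := by
    intro y hy
    obtain ⟨M, hM⟩ := eventually_atTop.1 (hlim.eventually_lt_const hy)
    exact ⟨M, fun x hx => le_of_not_gt fun hlt => absurd (hM x hlt.le) (not_lt.2 hx.2.le)⟩
  have hset : ∀ x, 0 < x → {y | x < G y} = Ioo 0 (u x) := by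
    intro x hx
    ext y
    simp only [mem_ofPred_eq, mem_Ioo, G]
    split_ifs with hy
    · constructor
      · intro h
        have hne : {x | 0 < x ∧ y < u x}.Nonempty := by
          by_contra hcon
          rw [not_nonempty_iff_eq_empty.1 hcon, Real.sSup_empty] at h
          exact absurd h (not_lt.2 hx.le)
        obtain ⟨z, hz, hxz⟩ := exists_lt_of_lt_csSup hne h
        exact ⟨hy, hz.2.trans_le (hanti hx hz.1 hxz.le)⟩
      · rintro ⟨-, h⟩
        -- Continuity of u provides some z > x with y < u(z), which is why G(y) > x holds strictly.
        have hev : ∀ᶠ z in 𝓝 x, y < u z :=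
          (hcont.continuousAt (Ioi_mem_nhds hx)).eventually_const_lt h
        obtain ⟨z, hz, hxz⟩ := ((hev.filter_mono nhdsWithin_le_nhds).and
          (self_mem_nhdsWithin : Ioi x ∈ 𝓝[>] x)).exists
        exact (mem_Ioi.1 hxz).trans_le (le_csSup (hbdd y hy) ⟨hx.trans hxz, hz⟩)
    · exact ⟨fun h => absurd h (not_lt.2 hx.le), fun h => absurd h.1 hy⟩
  have hnn : ∀ y, 0 ≤ G y := by
    intro y
    simp only [G]
    split_ifs
    · exact Real.sSup_nonneg fun x hx => hx.1.le
    · exact le_rfl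
  refine ⟨G, measurable_of_Ioi fun x => ?_, hnn, hset⟩
  rcases lt_trichotomy x 0 with hx | rfl | hx
  · have : G ⁻¹' Ioi x = univ := eq_univ_of_forall fun y => hx.trans_le (hnn y)
    rw [this]; exact MeasurableSet.univ
  · have : G ⁻¹' Ioi 0 = ⋃ n : ℕ, {y | 1 / ((n : ℝ) + 1) < G y} := by
      ext y
      simp only [mem_preimage, mem_Ioi, mem_iUnion, mem_ofPred_eq]
      exact ⟨fun h => exists_nat_one_div_lt h, fun ⟨n, hn⟩ => lt_trans (by positivity) hn⟩
    rw [this]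
    refine MeasurableSet.iUnion fun n => ?_
    rw [hset _ (by positivity)]
    exact measurableSet_Ioo
  · change MeasurableSet {y | x < G y}
    rw [hset x hx]
    exact measurableSet_Ioo

/-- Layer-cake formula: 1 - e^{-lG} = ∫_0^G l e^{-lx} dx, and {G > x} has length u(x). -/
theorem lintegral_one_sub_exp_tail_inverse {u G : ℝ → ℝ} (hu : ∀ x, 0 ≤ u x)
    (hG : Measurable G) (hG0 : ∀ y, 0 ≤ G y) (htail : ∀ x, 0 < x → {y | x < G y} = Ioo 0 (u x))
    {l : ℝ} (hl : 0 < l) (hint : IntegrableOn (fun x => Real.exp (-l * x) * u x) (Ioi 0)) :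
    ∫⁻ y, ENNReal.ofReal (1 - Real.exp (-(l * G y))) =
      ENNReal.ofReal (l * ∫ x in Ioi 0, Real.exp (-l * x) * u x) := by
  have h1 := lintegral_comp_eq_lintegral_meas_lt_mul (volume : Measure ℝ) (f := G)
    (g := fun x => l * Real.exp (-l * x)) (ae_of_all _ hG0) hG.aemeasurable
    (fun t _ => Continuous.intervalIntegrable (by fun_prop) _ _)
    (ae_of_all _ fun t => by positivity)
  have h2 : ∀ t : ℝ, ∫ x in (0 : ℝ)..t, l * Real.exp (-l * x) = 1 - Real.exp (-(l * t)) := by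
    intro t
    have := intervalIntegral.integral_eq_sub_of_hasDerivAt (a := 0) (b := t)
      (f := fun x => -Real.exp (-l * x)) (f' := fun x => l * Real.exp (-l * x)) (fun x _ => ?_)
      (Continuous.intervalIntegrable (by fun_prop) _ _)
    · rw [this]; simp; ring
    · have h3 : HasDerivAt (fun x : ℝ => -l * x) (-l) x := by
        simpa using (hasDerivAt_id x).const_mul (-l)
      exact h3.exp.neg.congr_deriv (by ring)
  simp only [h2] at h1
  rw [h1, ← integral_const_mul, ofReal_integral_eq_lintegral_ofReal (hint.const_mul l)]
  · refine setLIntegral_congr_fun measurableSet_Ioi fun x hx => ?_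
    rw [htail x hx, Real.volume_Ioo, sub_zero, ← ENNReal.ofReal_mul (hu x)]
    congr 1; ring
  · exact ae_of_all _ fun x => mul_nonneg hl.le (mul_nonneg (Real.exp_pos _).le (hu x))

theorem integrable_one_sub_exp_tail_inverse {u G : ℝ → ℝ} (hu : ∀ x, 0 ≤ u x)
    (hG : Measurable G) (hG0 : ∀ y, 0 ≤ G y) (htail : ∀ x, 0 < x → {y | x < G y} = Ioo 0 (u x))
    {l : ℝ} (hl : 0 < l) (hint : IntegrableOn (fun x => Real.exp (-l * x) * u x) (Ioi 0)) :
    Integrable (fun y => 1 - Real.exp (-(l * G y))) ∧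
      ∫ y, (1 - Real.exp (-(l * G y))) = l * ∫ x in Ioi 0, Real.exp (-l * x) * u x := by
  have h0 : ∀ y, 0 ≤ 1 - Real.exp (-(l * G y)) := fun y => by
    have := Real.exp_le_one_iff.2 (neg_nonpos.2 (mul_nonneg hl.le (hG0 y)))
    linarith
  have hm : Measurable fun y => 1 - Real.exp (-(l * G y)) := by fun_prop
  have h1 := lintegral_one_sub_exp_tail_inverse hu hG hG0 htail hl hint
  have h2 : 0 ≤ l * ∫ x in Ioi 0, Real.exp (-l * x) * u x :=
    mul_nonneg hl.le (integral_nonneg fun x => mul_nonneg (Real.exp_pos _).le (hu x))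
  refine ⟨⟨hm.aestronglyMeasurable, ?_⟩, ?_⟩
  · rw [hasFiniteIntegral_iff_ofReal (ae_of_all _ h0), h1]
    exact ENNReal.ofReal_lt_top
  · rw [integral_eq_lintegral_of_nonneg_ae (ae_of_all _ h0) hm.aestronglyMeasurable, h1,
      ENNReal.toReal_ofReal h2]

theorem min_one_le_two_mul_one_sub_exp {x : ℝ} (hx : 0 ≤ x) :
    min 1 x ≤ 2 * (1 - Real.exp (-x)) := by
  have h1 : Real.exp (-x) ≤ (1 + x)⁻¹ := by
    rw [Real.exp_neg]
    exact inv_anti₀ (by positivity) (by linarith [Real.add_one_le_exp x])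
  have h2 : min 1 x ≤ 2 * (1 - (1 + x)⁻¹) := by
    rw [show 2 * (1 - (1 + x)⁻¹) = 2 * x / (1 + x) by field_simp; ring, le_div_iff₀ (by positivity)]
    rcases min_cases 1 x with ⟨h1, h2⟩ | ⟨h1, h2⟩ <;> rw [h1] <;> nlinarith
  linarith

/-- A process which is the unit drift minus a subordinator is a Lévy process. -/
theorem isLevyProcess_drift_sub {Ω : Type*} [MeasurableSpace Ω] {P : Measure Ω}
    [IsProbabilityMeasure P] {S : ℝ≥0 → Ω → ℝ} (hm : ∀ t, Measurable (S t))
    (hzero : ∀ ω, S 0 ω = 0) (hmono : ∀ ω, Monotone fun t => S t ω)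
    (hcont : ∀ ω t, ContinuousWithinAt (fun t => S t ω) (Ici t) t) (hind : HasIndepIncrements S P)
    (hstat : ∀ s t : ℝ≥0, s ≤ t → P.map (fun ω => S t ω - S s ω) = P.map (S (t - s))) :
    IsLevyProcess (fun t ω => -S t ω + t) P :=
  IsLevyProcess.add_drift (X := fun t ω => -S t ω)
    { isProbabilityMeasure := inferInstance
      measurable := fun t => (hm t).neg
      cadlag := fun ω t => ⟨(hcont ω t).neg,
        ⟨_, ((hmono ω).tendsto_nhdsLT t).neg⟩⟩
      start_zero := ae_of_all _ fun ω => by simp [hzero]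
      indep_increments := hind.neg
      stationary_increments := fun s t hst => by
        have h := congrArg (Measure.map (fun x : ℝ => -x)) (hstat s t hst)
        rw [Measure.map_map (by fun_prop)
          (show Measurable fun ω => S t ω - S s ω from (hm t).sub (hm s)),
          Measure.map_map (by fun_prop) (hm _)] at h
        convert h using 2
        · ext ω
          simp only [Function.comp]
          ring
        · rfl }

/-- Existence of the Lévy process with unit drift whose negative jumps have a prescribed continuous
tail. -/
theorem exists_levyProcess_of_tail {u : ℝ → ℝ} (hu : ∀ x, 0 ≤ u x) (hanti : AntitoneOn u (Ioi 0))
    (hcont : ContinuousOn u (Ioi 0)) (hlim : Tendsto u atTop (𝓝 0))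
    (hint : ∀ l, 0 < l → IntegrableOn (fun x => Real.exp (-l * x) * u x) (Ioi 0)) :
    ∃ (Ω : Type) (_ : MeasurableSpace Ω) (P : Measure Ω) (Y : ℝ≥0 → Ω → ℝ),
      IsLevyProcess Y P ∧
      HasLaplaceExponent Y P (fun l => l - l * ∫ x in Ioi 0, Real.exp (-l * x) * u x) ∧
      ∃ (μ : ℝ) (ν : Measure ℝ), HasLevyTriplet Y P μ 0 ν ∧ ν (Ioi 0) = 0 ∧
        ∀ x, 0 < x → ν (Iio (-x)) = ENNReal.ofReal (u x) := by
  obtain ⟨G, hG, hG0, htail⟩ := exists_tail_inverse hanti hcont hlim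
  have hGint : Integrable (fun y => min 1 (G y)) := by
    have h := (integrable_one_sub_exp_tail_inverse hu hG hG0 htail one_pos (hint 1 one_pos)).1
    refine (h.const_mul 2).mono' (by fun_prop) (ae_of_all _ fun y => ?_)
    rw [Real.norm_of_nonneg (le_min zero_le_one (hG0 y)), one_mul]
    exact min_one_le_two_mul_one_sub_exp (hG0 y)
  obtain ⟨Ω, mΩ, P, S, hP, hSm, hS0, hSmono, hScont, hSind, hSstat, hSlaw⟩ :=
    exists_subordinator hG hG0 hGint
  have hSnn : ∀ t ω, 0 ≤ S t ω := fun t ω => by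
    rw [← hS0 ω]; exact hSmono ω (zero_le (a := t))
  refine ⟨Ω, mΩ, P, fun t ω => -S t ω + t,
    isLevyProcess_drift_sub hSm hS0 hSmono hScont hSind hSstat, fun t l hl => ?_, ?_⟩
  · have hexp : ∀ ω, Real.exp (l * (-S t ω + t)) =
        Real.exp (-l * S t ω) * Real.exp (l * t) := fun ω => by
      rw [← Real.exp_add]; ring_nf
    simp only [hexp]
    refine ⟨Integrable.mul_const (Integrable.of_bound (C := 1)
      ((hSm t).const_mul _).exp.aestronglyMeasurable (ae_of_all _ fun ω => ?_)) _, ?_⟩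
    · rw [Real.norm_of_nonneg (Real.exp_pos _).le]
      exact Real.exp_le_one_iff.2 (by nlinarith [hSnn t ω])
    · have h1 := hSlaw t (-l : ℝ) (by simpa using hl)
      have h2 : ∀ ω, Complex.exp (((-l : ℝ) : ℂ) * S t ω) = ((Real.exp (-l * S t ω) : ℝ) : ℂ) :=
        fun ω => by push_cast; rfl
      have h3 : ∀ y, Complex.exp (((-l : ℝ) : ℂ) * G y) - 1 =
          ((-(1 - Real.exp (-(l * G y))) : ℝ) : ℂ) := fun y => by
        push_cast; ring_nf
      have h4 : ∫ y, (1 - Real.exp (-(l * G y))) =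
          l * ∫ x in Ioi 0, Real.exp (-l * x) * u x := by
        rcases hl.eq_or_lt with rfl | hl
        · simp
        · exact (integrable_one_sub_exp_tail_inverse hu hG hG0 htail hl (hint l hl)).2
      simp only [h2, h3] at h1
      rw [integral_complex_ofReal, integral_complex_ofReal, integral_neg, h4, ← Complex.ofReal_mul,
        ← Complex.ofReal_exp] at h1
      rw [integral_mul_const, Complex.ofReal_injective h1, ← Real.exp_add]
      ring_nf
  -- The jumps of Y are -G(y). The image measure is cut to (-∞, 0) because G vanishes on (-∞, 0] at
  -- least and so creates infinite mass at 0.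
  · set κ : Measure ℝ := volume.map fun y => -G y with hκ
    have hGn : Measurable fun y => -G y := hG.neg
    have hκle : ∀ᵐ x ∂κ, x ≤ 0 := by
      rw [hκ, ae_map_iff hGn.aemeasurable measurableSet_Iic]
      exact ae_of_all _ fun y => by simpa using hG0 y
    have hlin : ∫⁻ x, ENNReal.ofReal (min 1 (x ^ 2)) ∂(κ.restrict (Iio 0)) < ∞ := by
      refine (setLIntegral_le_lintegral _ _).trans_lt ?_
      rw [hκ, lintegral_map (by fun_prop) hGn]
      have := hGint.2
      rw [hasFiniteIntegral_iff_ofReal (ae_of_all _ fun y => le_min zero_le_one (hG0 y))] at this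
      refine (lintegral_mono fun y => ENNReal.ofReal_le_ofReal ?_).trans_lt this
      have := hG0 y
      rw [neg_sq]
      rcases min_cases 1 (G y) with ⟨h1, h2⟩ | ⟨h1, h2⟩ <;> rw [h1]
      · exact min_le_left _ _
      · exact (min_le_right _ _).trans (by nlinarith)
    have hsmall : Integrable fun y => if |-G y| < 1 then ((-G y : ℝ) : ℂ) else 0 := by
      refine hGint.mono' (Measurable.ite (measurableSet_lt (by fun_prop) measurable_const)
        (by fun_prop) measurable_const).aestronglyMeasurable (ae_of_all _ fun y => ?_)
      rw [abs_neg, abs_of_nonneg (hG0 y)]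
      split_ifs with h
      · rw [min_eq_right h.le, Complex.norm_real, norm_neg, Real.norm_of_nonneg (hG0 y)]
      · rw [norm_zero]; exact le_min zero_le_one (hG0 y)
    have hsmall' : ∫ y, (if |-G y| < 1 then ((-G y : ℝ) : ℂ) else 0) =
        ((∫ y, if |-G y| < 1 then -G y else 0 : ℝ) : ℂ) := by
      rw [← integral_complex_ofReal]
      refine integral_congr_ae (ae_of_all _ fun y => ?_)
      simp only; split_ifs <;> simp
    have hexpint : ∀ θ : ℝ, Integrable fun y => Complex.exp (-(Complex.I * θ) * G y) - 1 := by
      intro θ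
      refine integrable_exp_sub_one (h := fun y => |θ| * G y) (by fun_prop) (fun y => ?_)
        (fun y => ?_) ?_
      · simp
      · simp [abs_of_nonneg (hG0 y)]
      · refine (hGint.const_mul (1 + |θ|)).mono' (by fun_prop) (ae_of_all _ fun y => ?_)
        have h3 := hG0 y
        have h4 := abs_nonneg θ
        rw [Real.norm_of_nonneg (by positivity)]
        rcases min_cases 1 (G y) with ⟨h1, h2⟩ | ⟨h1, h2⟩ <;> rw [h1]
        · exact (min_le_left _ _).trans (by linarith)
        · exact (min_le_right _ _).trans (by nlinarith)
    -- In the convention e^{-tΨ} with Ψ containing iμθ, the unit drift contributes -1; the second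
    -- term undoes the compensation of small jumps.
    refine ⟨-1 - ∫ y, (if |-G y| < 1 then -G y else 0), κ.restrict (Iio 0), ⟨?_, hlin, ?_⟩, ?_,
      fun x hx => ?_⟩
    · rw [Measure.restrict_apply (measurableSet_singleton 0)]
      simp
    · intro t θ
      have h1 : ∀ ω, Complex.exp (Complex.I * θ * ((-S t ω + t : ℝ) : ℂ)) =
          Complex.exp (-(Complex.I * θ) * S t ω) * Complex.exp (Complex.I * θ * t) := fun ω => by
        rw [← Complex.exp_add]; push_cast; ring_nf
      simp only [h1]
      rw [integral_mul_const, hSlaw t _ (by simp), ← Complex.exp_add]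
      congr 1
      have h2 : ∫ x : ℝ, (1 - Complex.exp (Complex.I * θ * x) +
          Complex.I * θ * (if |x| < 1 then (x : ℂ) else 0)) ∂(κ.restrict (Iio 0)) =
          -(∫ y, (Complex.exp (-(Complex.I * θ) * G y) - 1)) +
          Complex.I * θ * ∫ y, (if |-G y| < 1 then ((-G y : ℝ) : ℂ) else 0) := by
        rw [setIntegral_eq_integral_of_ae_compl_eq_zero, hκ, integral_map hGn.aemeasurable
          (measurable_levyKhintchine_integrand θ).aestronglyMeasurable, ← integral_neg,
          ← integral_const_mul]
        · refine Eq.trans (integral_congr_ae (ae_of_all _ fun y => ?_))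
            (integral_add (hexpint θ).neg (hsmall.const_mul _))
          simp only
          have : Complex.I * θ * ((-G y : ℝ) : ℂ) = -(Complex.I * θ) * G y := by
            push_cast; ring
          rw [this]; ring
        · filter_upwards [hκle] with x hx hx0
          have : x = 0 := le_antisymm hx (not_lt.1 hx0)
          simp [this]
      rw [levyKhintchineExponent, h2, hsmall']
      push_cast
      ring
    · rw [Measure.restrict_apply measurableSet_Ioi]
      have : Ioi (0 : ℝ) ∩ Iio 0 = ∅ := by ext; simp; intro h; exact h.le
      rw [this, measure_empty]
    · rw [Measure.restrict_apply measurableSet_Iio, inter_eq_left.2 (Iio_subset_Iio (by linarith)),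
        hκ, Measure.map_apply hGn measurableSet_Iio]
      have : (fun y => -G y) ⁻¹' Iio (-x) = {y | x < G y} := by ext y; simp
      rw [this, htail x hx, Real.volume_Ioo, sub_zero]

/-! ### Scale functions: uniqueness and construction by primitives -/

/-- Tilting W(x) dx by e^{-βx} yields a finite measure whose Laplace transform at the integers is
known, as the uniqueness theorem requires. -/
theorem IsScaleFunction.integral_withDensity {ψ W : ℝ → ℝ} (h : IsScaleFunction ψ W) {β : ℝ}
    (hβ : largestRoot ψ < β) (k : ℕ) :
    ∫ x, Real.exp (-(k * x)) ∂((volume.restrict (Ioi 0)).withDensity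
      fun x => ENNReal.ofReal (Real.exp (-β * x) * W x)) = 1 / ψ (β + k) := by
  have hm := (h.laplace β hβ).1.aestronglyMeasurable.aemeasurable
  rw [integral_withDensity_eq_integral_toReal_smul₀ hm.ennreal_ofReal
    (ae_of_all _ fun x => ENNReal.ofReal_lt_top),
    ← (h.laplace (β + k) (hβ.trans_le (le_add_of_nonneg_right k.cast_nonneg))).2]
  refine integral_congr_ae (ae_of_all _ fun x => ?_)
  simp only [smul_eq_mul]
  rw [ENNReal.toReal_ofReal (mul_nonneg (Real.exp_pos _).le (h.nonneg x)),
    show -(β + k) * x = -β * x + -(k * x) by ring, Real.exp_add]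
  ring

theorem IsScaleFunction.unique {ψ W₁ W₂ : ℝ → ℝ} (h₁ : IsScaleFunction ψ W₁)
    (h₂ : IsScaleFunction ψ W₂) : W₁ = W₂ := by
  have hβ : largestRoot ψ < largestRoot ψ + 1 := lt_add_one _
  set β := largestRoot ψ + 1
  have hfin : ∀ {W : ℝ → ℝ}, IsScaleFunction ψ W →
      IsFiniteMeasure ((volume.restrict (Ioi 0)).withDensity
        fun x => ENNReal.ofReal (Real.exp (-β * x) * W x)) := fun h =>
    isFiniteMeasure_withDensity_ofReal (h.laplace β hβ).1.2
  have hpos : ∀ W : ℝ → ℝ, ∀ᵐ x ∂((volume.restrict (Ioi 0)).withDensity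
      fun x => ENNReal.ofReal (Real.exp (-β * x) * W x)), 0 ≤ x := fun W =>
    (withDensity_absolutelyContinuous _ _).ae_le
      ((ae_restrict_mem measurableSet_Ioi).mono fun x hx => (mem_Ioi.1 hx).le)
  have := hfin h₁
  have := hfin h₂
  have heq := ext_of_integral_exp_neg_nat (hpos W₁) (hpos W₂) fun k => by
    rw [h₁.integral_withDensity hβ, h₂.integral_withDensity hβ]
  have hae := (withDensity_eq_iff
    (h₁.laplace β hβ).1.aestronglyMeasurable.aemeasurable.ennreal_ofReal
    (h₂.laplace β hβ).1.aestronglyMeasurable.aemeasurable.ennreal_ofReal (by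
      have := measure_lt_top ((volume.restrict (Ioi 0)).withDensity
        fun x => ENNReal.ofReal (Real.exp (-β * x) * W₁ x)) univ
      rw [withDensity_apply _ MeasurableSet.univ, Measure.restrict_univ] at this
      exact this.ne)).1 heq
  have hW : ∀ᵐ x ∂(volume.restrict (Ioi 0)), W₁ x = W₂ x := by
    filter_upwards [hae] with x hx
    have := (ENNReal.ofReal_eq_ofReal_iff (mul_nonneg (Real.exp_pos _).le (h₁.nonneg x))
      (mul_nonneg (Real.exp_pos _).le (h₂.nonneg x))).1 hx
    exact mul_left_cancel₀ (Real.exp_pos _).ne' this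
  ext x
  rcases lt_or_ge x 0 with hx | hx
  · rw [h₁.eq_zero_of_neg x hx, h₂.eq_zero_of_neg x hx]
  -- Almost everywhere equality becomes equality: every right neighbourhood of x has positive
  -- measure, and both functions are right-continuous.
  · refine tendsto_nhds_unique_of_frequently_eq (l := 𝓝[>] x)
      ((h₁.right_continuous x hx).mono Ioi_subset_Ici_self)
      ((h₂.right_continuous x hx).mono Ioi_subset_Ici_self) ?_
    rw [frequently_nhdsWithin_iff, frequently_nhds_iff]
    intro V hxV hV
    have hne : (volume (V ∩ Ioi x)) ≠ 0 := by
      refine ((hV.inter isOpen_Ioi).measure_pos volume ?_).ne'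
      obtain ⟨y, hy⟩ := ((Filter.Eventually.filter_mono nhdsWithin_le_nhds
        (hV.eventually_mem hxV)).and (self_mem_nhdsWithin : Ioi x ∈ 𝓝[>] x)).exists
      exact ⟨y, hy⟩
    by_contra hcon
    push Not at hcon
    refine hne (measure_mono_null (fun y hy => ?_) (ae_iff.1 ((ae_restrict_iff'
      measurableSet_Ioi).1 hW)))
    simp only [mem_ofPred_eq, Classical.not_imp]
    exact ⟨hx.trans_lt hy.2, fun h => hcon y hy.1 h hy.2⟩

/-- The primitive of a nonnegative function on `(0, ∞)` whose Laplace transform is finite. -/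
theorem exists_primitive_laplace {u : ℝ → ℝ} (hu : ∀ x, 0 ≤ u x)
    (hcont : ContinuousOn u (Ioi 0))
    (hint : ∀ θ, 0 < θ → IntegrableOn (fun x => Real.exp (-θ * x) * u x) (Ioi 0)) :
    ∃ V : ℝ → ℝ, (∀ x, 0 ≤ V x) ∧ (∀ x, x < 0 → V x = 0) ∧ Continuous V ∧
      (∀ x, 0 < x → HasDerivAt V (u x) x) ∧
      ∀ θ, 0 < θ → IntegrableOn (fun x => Real.exp (-θ * x) * V x) (Ioi 0) ∧
        ∫ x in Ioi 0, Real.exp (-θ * x) * V x =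
          (∫ x in Ioi 0, Real.exp (-θ * x) * u x) / θ := by
  set v : ℝ → ℝ := (Ioi 0).indicator u with hv
  have hv0 : ∀ x, 0 ≤ v x := fun x => indicator_nonneg (fun x _ => hu x) x
  have hvint : ∀ a b, IntervalIntegrable v volume a b := by
    intro a b
    have h1 : Integrable ((Ioi 0).indicator fun x => Real.exp (-1 * x) * u x) :=
      (integrable_indicator_iff measurableSet_Ioi).2 (hint 1 one_pos)
    have h2 := (h1.intervalIntegrable (a := a) (b := b)).continuousOn_mul
      (g := fun x => Real.exp (1 * x)) (by fun_prop)
    refine h2.congr (fun x _ => ?_)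
    simp only [hv, indicator_apply]
    split_ifs
    · rw [← mul_assoc, ← Real.exp_add]; simp
    · simp
  set V : ℝ → ℝ := fun x => ∫ s in (0 : ℝ)..x, v s with hV
  have hVneg : ∀ x, x < 0 → V x = 0 := by
    intro x hx
    simp only [hV]
    rw [intervalIntegral.integral_zero_ae]
    refine ae_of_all _ fun s hs => ?_
    rw [uIoc_of_ge hx.le] at hs
    exact indicator_of_notMem (by simpa using hs.2) _
  have hVnn : ∀ x, 0 ≤ V x := fun x => by
    rcases lt_or_ge x 0 with hx | hx
    · rw [hVneg x hx]
    · exact intervalIntegral.integral_nonneg hx fun s _ => hv0 s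
  have hVc : Continuous V := intervalIntegral.continuous_primitive hvint 0
  refine ⟨V, hVnn, hVneg, hVc, fun x hx => ?_, fun θ hθ => ?_⟩
  · have hev : v =ᶠ[𝓝 x] u := by
      filter_upwards [Ioi_mem_nhds hx] with y hy using indicator_of_mem hy _
    have hm : StronglyMeasurableAtFilter v (𝓝 x) :=
      ⟨Ioi 0, Ioi_mem_nhds hx,
        ((hcont.aestronglyMeasurable measurableSet_Ioi).congr (by
          filter_upwards [ae_restrict_mem measurableSet_Ioi] with y hy
          exact (indicator_of_mem hy _).symm))⟩
    have h := intervalIntegral.integral_hasDerivAt_right (hvint 0 x) hm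
      ((hcont.continuousAt (Ioi_mem_nhds hx)).congr hev.symm)
    rwa [show v x = u x from hev.self_of_nhds] at h
  · have hlint : ∫⁻ x in Ioi 0, ENNReal.ofReal (Real.exp (-θ * x) * V x) =
        ENNReal.ofReal ((∫ x in Ioi 0, Real.exp (-θ * x) * u x) / θ) := by
      -- Layer-cake formula for the measure e^{-θx} dx, whose mass beyond t is e^{-θt}/θ.
      have h1 := lintegral_comp_eq_lintegral_meas_lt_mul ((volume.restrict (Ioi 0)).withDensity
        fun x => ENNReal.ofReal (Real.exp (-θ * x))) (f := fun x => x) (g := v)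
        ((withDensity_absolutelyContinuous _ _).ae_le
          ((ae_restrict_mem measurableSet_Ioi).mono fun x hx => (mem_Ioi.1 hx).le))
        measurable_id.aemeasurable (fun t _ => hvint 0 t) (ae_of_all _ hv0)
      rw [lintegral_withDensity_eq_lintegral_mul _ (by fun_prop)
        (show Measurable fun x => ENNReal.ofReal (V x) from hVc.measurable.ennreal_ofReal)] at h1
      simp only [Pi.mul_apply, ← ENNReal.ofReal_mul (Real.exp_pos _).le] at h1
      rw [h1, ← integral_div, ofReal_integral_eq_lintegral_ofReal ((hint θ hθ).div_const θ)
        (ae_of_all _ fun x => div_nonneg (mul_nonneg (Real.exp_pos _).le (hu x)) hθ.le)]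
      refine setLIntegral_congr_fun measurableSet_Ioi fun t ht => ?_
      have ht' : (0 : ℝ) < t := ht
      have hset : {a : ℝ | t < a} = Ioi t := rfl
      rw [hset, withDensity_apply _ measurableSet_Ioi, Measure.restrict_restrict measurableSet_Ioi,
        inter_eq_left.2 (Ioi_subset_Ioi ht'.le), ← ofReal_integral_eq_lintegral_ofReal
        (integrableOn_exp_mul_Ioi (neg_lt_zero.2 hθ) t) (ae_of_all _ fun x => (Real.exp_pos _).le),
        integral_exp_mul_Ioi (neg_lt_zero.2 hθ), hv, indicator_of_mem ht,
        neg_div_neg_eq, ← ENNReal.ofReal_mul (by positivity)]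
      congr 1; ring
    have hnn : ∀ x, 0 ≤ Real.exp (-θ * x) * V x := fun x =>
      mul_nonneg (Real.exp_pos _).le (hVnn x)
    have hm : Measurable fun x => Real.exp (-θ * x) * V x := by
      have := hVc.measurable; fun_prop
    refine ⟨⟨hm.aestronglyMeasurable, ?_⟩, ?_⟩
    · rw [hasFiniteIntegral_iff_ofReal (ae_of_all _ hnn), hlint]
      exact ENNReal.ofReal_lt_top
    · rw [integral_eq_lintegral_of_nonneg_ae (ae_of_all _ hnn) hm.aestronglyMeasurable, hlint,
        ENNReal.toReal_ofReal]
      exact div_nonneg (integral_nonneg fun x => mul_nonneg (Real.exp_pos _).le (hu x)) hθ.le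

/-! ### Identification of laws by the Laplace exponent -/

/-- The linear bound on `ψ` makes ct - X_t nonnegative, so its law is determined by a Laplace
transform at the integers. This passes from real exponentials to characteristic functions without
analytic continuation. -/
theorem HasLaplaceExponent.map_drift_sub_eq {Ω Ω' : Type*} [MeasurableSpace Ω]
    [MeasurableSpace Ω'] {P : Measure Ω} {P' : Measure Ω'} {X : ℝ≥0 → Ω → ℝ} {Y : ℝ≥0 → Ω' → ℝ}
    [IsProbabilityMeasure P] [IsProbabilityMeasure P'] {ψ : ℝ → ℝ} {c : ℝ}
    (hXm : ∀ t, Measurable (X t)) (hYm : ∀ t, Measurable (Y t))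
    (hX : HasLaplaceExponent X P ψ) (hY : HasLaplaceExponent Y P' ψ)
    (h : ∀ l, 0 < l → ψ l ≤ c * l) (t : ℝ≥0) :
    P.map (fun ω => c * t - X t ω) = P'.map (fun ω => c * t - Y t ω) := by
  have hm : Measurable fun ω => c * t - X t ω := (hXm t).const_sub _
  have hm' : Measurable fun ω => c * t - Y t ω := (hYm t).const_sub _
  refine ext_of_integral_exp_neg_nat ?_ ?_ fun k => ?_
  · rw [ae_map_iff hm.aemeasurable measurableSet_Ici]
    filter_upwards [hX.ae_le_mul h t] with ω hω using sub_nonneg.2 hω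
  · rw [ae_map_iff hm'.aemeasurable measurableSet_Ici]
    filter_upwards [hY.ae_le_mul h t] with ω hω using sub_nonneg.2 hω
  · rw [integral_map hm.aemeasurable (by fun_prop), integral_map hm'.aemeasurable (by fun_prop)]
    have hexp : ∀ x : ℝ, Real.exp (-(k * (c * t - x))) =
        Real.exp (-(k * (c * t))) * Real.exp (k * x) := fun x => by
      rw [← Real.exp_add]; ring_nf
    simp only [hexp, integral_const_mul]
    rw [(hX t k k.cast_nonneg).2, (hY t k k.cast_nonneg).2]

theorem HasLaplaceExponent.integral_cexp_eq {Ω Ω' : Type*} [MeasurableSpace Ω]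
    [MeasurableSpace Ω'] {P : Measure Ω} {P' : Measure Ω'} {X : ℝ≥0 → Ω → ℝ} {Y : ℝ≥0 → Ω' → ℝ}
    [IsProbabilityMeasure P] [IsProbabilityMeasure P'] {ψ : ℝ → ℝ} {c : ℝ}
    (hXm : ∀ t, Measurable (X t)) (hYm : ∀ t, Measurable (Y t))
    (hX : HasLaplaceExponent X P ψ) (hY : HasLaplaceExponent Y P' ψ)
    (h : ∀ l, 0 < l → ψ l ≤ c * l) (t : ℝ≥0) (θ : ℝ) :
    ∫ ω, Complex.exp (Complex.I * θ * X t ω) ∂P =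
      ∫ ω, Complex.exp (Complex.I * θ * Y t ω) ∂P' := by
  have hm : Measurable fun ω => c * t - X t ω := (hXm t).const_sub _
  have hm' : Measurable fun ω => c * t - Y t ω := (hYm t).const_sub _
  have key := congrArg (fun κ : Measure ℝ =>
    ∫ x, Complex.exp (Complex.I * θ * ((c * t - x : ℝ) : ℂ)) ∂κ)
    (hX.map_drift_sub_eq hXm hYm hY h t)
  rw [integral_map hm.aemeasurable (by fun_prop), integral_map hm'.aemeasurable (by fun_prop)]
    at key
  simpa only [sub_sub_cancel] using key

/-! ### The shifted exponent and the main theorem -/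

theorem largestRoot_eq_zero {ψ : ℝ → ℝ} (h0 : ψ 0 = 0) (hpos : ∀ θ, 0 < θ → 0 < ψ θ) :
    largestRoot ψ = 0 := by
  have : {l : ℝ | 0 ≤ l ∧ ψ l = 0} = {0} := by
    ext l
    simp only [mem_ofPred_eq, mem_singleton_iff]
    refine ⟨fun h => ?_, fun h => by rw [h]; exact ⟨le_rfl, h0⟩⟩
    by_contra hne
    exact (hpos l (lt_of_le_of_ne h.1 (Ne.symm hne))).ne' h.2
  rw [largestRoot, this, csSup_singleton]

theorem shiftedExponent_pos {ψ : ℝ → ℝ} (hpos : ∀ θ, 0 < θ → 0 < ψ θ) {θ : ℝ} (hθ : 0 < θ) :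
    0 < shiftedExponent ψ θ :=
  div_pos (mul_pos hθ (hpos θ hθ)) (add_pos hθ (hpos θ hθ))

theorem shiftedExponent_zero (ψ : ℝ → ℝ) : shiftedExponent ψ 0 = 0 := by simp [shiftedExponent]

/-- Squeeze 0 ≤ ψˢ ≤ ψ. Used to rule out monotone paths for the constructed process. -/
theorem tendsto_shiftedExponent_div {ψ : ℝ → ℝ} (hpos : ∀ θ, 0 < θ → 0 < ψ θ)
    (h : Tendsto (fun θ => ψ θ / θ) (𝓝[>] 0) (𝓝 0)) :
    Tendsto (fun θ => shiftedExponent ψ θ / θ) (𝓝[>] 0) (𝓝 0) := by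
  refine tendsto_of_tendsto_of_tendsto_of_le_of_le' tendsto_const_nhds h ?_ ?_ <;>
    filter_upwards [self_mem_nhdsWithin] with θ hθ <;> have hθ' : 0 < θ := hθ <;>
    have hψ := hpos θ hθ'
  · exact (div_pos (shiftedExponent_pos hpos hθ') hθ').le
  · refine div_le_div_of_nonneg_right ?_ hθ'.le
    rw [shiftedExponent, div_le_iff₀ (by positivity)]
    nlinarith

/-- On the Laplace side this is 1/ψˢ(β) = 1/β + 1/ψ(β); both largest roots are 0. -/
theorem isScaleFunction_shiftedScale {ψ W : ℝ → ℝ} (hW : IsScaleFunction ψ W) (h0 : ψ 0 = 0)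
    (hpos : ∀ θ, 0 < θ → 0 < ψ θ) : IsScaleFunction (shiftedExponent ψ) (shiftedScale W) where
  nonneg x := indicator_nonneg (fun x _ => add_nonneg zero_le_one (hW.nonneg x)) x
  eq_zero_of_neg x hx := indicator_of_notMem (by simpa using hx) _
  right_continuous x hx := by
    refine ((continuousWithinAt_const (b := (1 : ℝ))).add (hW.right_continuous x hx)).congr (fun y hy => ?_) ?_
    · exact indicator_of_mem (mem_Ici.2 (hx.trans hy)) _
    · exact indicator_of_mem (mem_Ici.2 hx) _
  laplace β hβ := by
    rw [largestRoot_eq_zero (shiftedExponent_zero ψ) fun θ => shiftedExponent_pos hpos] at hβ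
    obtain ⟨h1, h2⟩ := hW.laplace β (by rwa [largestRoot_eq_zero h0 hpos])
    have h3 : ∀ x ∈ Ioi (0 : ℝ), Real.exp (-β * x) * shiftedScale W x =
        Real.exp (-β * x) + Real.exp (-β * x) * W x := fun x hx => by
      rw [shiftedScale, indicator_of_mem (Ioi_subset_Ici_self hx)]; ring
    have h4 := integrableOn_exp_mul_Ioi (neg_lt_zero.2 hβ) 0
    refine ⟨(h4.add h1).congr_fun (fun x hx => (h3 x hx).symm) measurableSet_Ioi, ?_⟩
    rw [setIntegral_congr_fun measurableSet_Ioi h3, integral_add h4 h1, h2,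
      integral_exp_mul_Ioi (neg_lt_zero.2 hβ)]
    have := hpos β hβ
    simp only [shiftedExponent, mul_zero, Real.exp_zero]
    field_simp
    ring

theorem IsCompleteBernstein.isResolventMean_inv_one_add {φ : ℝ → ℝ} (hφ : IsCompleteBernstein φ)
    {g : ℝ → ℝ} (hg : ∀ θ, 0 < θ → g θ = (1 + φ θ)⁻¹) : IsResolventMean g := by
  obtain ⟨c, κ, U, hc, hκ, hU, hfin, h⟩ := hφ.exists_integral
  refine (isResolventMean_inv_of_integral (c := 1 + c) (by linarith) hκ hU hfin).congr
    fun θ hθ => ?_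
  rw [hg θ hθ, h θ hθ]
  congr 1; ring

theorem mainTheorem10 {Ω : Type*} [MeasurableSpace Ω] (P : Measure Ω) (X : ℝ≥0 → Ω → ℝ)
    (ψ W : ℝ → ℝ)
    (hX : IsSpectrallyNegativeLevy X P)
    (hψ : HasLaplaceExponent X P ψ)
    (hvar : ¬ HasBoundedVariationPaths X P)
    (hψ' : HasDerivWithinAt ψ 0 (Ioi 0) 0)
    (hW : IsCompleteScaleFunction ψ W) :
    -- a spectrally negative Lévy process with exponent `ψˢ` exists
    (∃ (Ω' : Type) (_ : MeasurableSpace Ω') (P' : Measure Ω') (Y : ℝ≥0 → Ω' → ℝ),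
      IsSpectrallyNegativeLevy Y P' ∧ HasLaplaceExponent Y P' (shiftedExponent ψ)) ∧
    -- `1 + W` is its scale function
    IsScaleFunction (shiftedExponent ψ) (shiftedScale W) ∧
    -- `X_t + t` is spectrally negative with exponent `ψ(θ) + θ`, and has a scale function
    IsSpectrallyNegativeLevy (fun t ω => X t ω + t) P ∧
    HasLaplaceExponent (fun t ω => X t ω + t) P (fun θ => ψ θ + θ) ∧
    (∃ Wt : ℝ → ℝ, IsScaleFunction (fun θ => ψ θ + θ) Wt) ∧
    -- every spectrally negative Lévy process with exponent `ψˢ` has bounded variation paths, and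
    -- the tail of its jump measure is the derivative of the scale function for `ψ(θ) + θ`
    ∀ (Ω' : Type*) [MeasurableSpace Ω'] (P' : Measure Ω') (Y : ℝ≥0 → Ω' → ℝ),
      IsSpectrallyNegativeLevy Y P' → HasLaplaceExponent Y P' (shiftedExponent ψ) →
        HasBoundedVariationPaths Y P' ∧
        ∀ (μ σ : ℝ) (ν : Measure ℝ), HasLevyTriplet Y P' μ σ ν →
          ∀ Wt : ℝ → ℝ, IsScaleFunction (fun θ => ψ θ + θ) Wt →
            ∀ x, 0 < x → ν (Iio (-x)) < ∞ ∧ HasDerivAt Wt (ν (Iio (-x))).toReal x := by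
  have := hX.isLevyProcess.isProbabilityMeasure
  have h0 := hψ.apply_zero
  have htend := hψ.tendsto_div hψ'
  have hpos : ∀ θ, 0 < θ → 0 < ψ θ := fun θ hθ => hX.exponent_pos hψ htend hθ
  obtain ⟨hWs, φ, hφ, hφψ⟩ := hW
  have hφψ' : ∀ θ, 0 < θ → φ θ = ψ θ / θ := fun θ hθ => by
    rw [hφψ θ hθ, largestRoot_eq_zero h0 hpos, sub_zero, mul_div_cancel_left₀ _ hθ.ne']
  set g : ℝ → ℝ := fun θ => θ / (θ + ψ θ) with hg
  have hgr : IsResolventMean g := hφ.isResolventMean_inv_one_add fun θ hθ => by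
    have := hpos θ hθ
    rw [hφψ' θ hθ, hg]
    field_simp
  have hg1 : ∀ θ, 0 < θ → g θ ≤ 1 := fun θ hθ => by
    have := hpos θ hθ
    rw [div_le_one (by positivity)]
    linarith
  -- The only place where the constant part of g is excluded: g ≥ ε on (0, ∞) means ψ(θ) ≤ θ/ε
  -- there, which forces bounded variation of X.
  have hginf : ∀ ε > 0, ∃ θ, 0 < θ ∧ g θ < ε := by
    intro ε hε
    by_contra! hcon
    refine hvar (hX.isLevyProcess.hasBoundedVariationPaths hψ (c := ε⁻¹) fun θ hθ => ?_)
    have h1 := hpos θ hθ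
    have h2 := hcon θ hθ
    rw [le_div_iff₀ (by positivity)] at h2
    rw [inv_mul_eq_div, le_div_iff₀ hε]
    nlinarith
  obtain ⟨u, hu, hanti, hcont, hlim, hlap⟩ := hgr.exists_laplace_density hginf hg1
  obtain ⟨Ω₀, _, P₀, Y₀, hY₀, hψ₀, μ₀, ν₀, htrip₀, hν₀, htail⟩ :=
    exists_levyProcess_of_tail hu hanti hcont hlim fun l hl => (hlap l hl).1
  -- Here l - l g(l) = lψ(l)/(l + ψ(l)).
  have hψs₀ : HasLaplaceExponent Y₀ P₀ (shiftedExponent ψ) := fun t l hl => by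
    refine ⟨(hψ₀ t l hl).1, ?_⟩
    rw [(hψ₀ t l hl).2]
    rcases hl.eq_or_lt with rfl | hl
    · simp [shiftedExponent]
    · have := hpos l hl
      simp only [(hlap l hl).2, hg, shiftedExponent]
      congr 2
      field_simp
      ring
  have hle : ∀ l, 0 < l → shiftedExponent ψ l ≤ 1 * l := fun l hl => by
    have := hpos l hl
    rw [shiftedExponent, div_le_iff₀ (by positivity)]
    nlinarith
  have hnm := hY₀.not_monotone_of_exponent hψs₀ (tendsto_shiftedExponent_div hpos htend)
    (shiftedExponent_pos hpos one_pos)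
  obtain ⟨V, hVnn, hVneg, hVc, hVd, hVlap⟩ :=
    exists_primitive_laplace hu hcont fun θ hθ => (hlap θ hθ).1
  -- Integration divides the Laplace transform by θ, and g(θ)/θ = 1/(θ + ψ(θ)).
  have hV : IsScaleFunction (fun θ => ψ θ + θ) V :=
    { nonneg := hVnn
      eq_zero_of_neg := hVneg
      right_continuous := fun x _ => hVc.continuousWithinAt
      laplace := fun β hβ => by
        rw [largestRoot_eq_zero (by simp [h0]) fun θ hθ => add_pos (hpos θ hθ) hθ] at hβ
        refine ⟨(hVlap β hβ).1, ?_⟩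
        have := hpos β hβ
        rw [(hVlap β hβ).2, (hlap β hβ).2, hg]
        field_simp
        ring }
  refine ⟨⟨Ω₀, _, P₀, Y₀, ⟨hY₀, ⟨μ₀, 0, ν₀, htrip₀, hν₀⟩, hnm.1, hnm.2⟩, hψs₀⟩,
    isScaleFunction_shiftedScale hWs h0 hpos, hX.add_drift hvar, hψ.add_drift, ⟨V, hV⟩, ?_⟩
  intro Ω' _ P' Y hY hψY
  refine ⟨hY.isLevyProcess.hasBoundedVariationPaths hψY hle, fun μ σ ν htrip Wt hWt x hx => ?_⟩
  have := hY₀.isProbabilityMeasure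
  have := hY.isLevyProcess.isProbabilityMeasure
  have hν : ν = ν₀ := htrip.levyMeasure_eq htrip₀ fun t θ =>
    hψY.integral_cexp_eq hY.isLevyProcess.measurable hY₀.measurable hψs₀ hle t θ
  rw [hν, htail x hx, hWt.unique hV, ENNReal.toReal_ofReal (hu x)]
  exact ⟨ENNReal.ofReal_lt_top, hVd x hx⟩
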